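/- **Setting.** Hilbert spaces are complex; $L(\mathcal U,\mathcal Y)$ denotes the bounded linear operators and $L(\mathcal U)=L(\mathcal U,\mathcal U)$. Fix $N$ and sizes $n_1,\ldots,n_N$, and consider tuples $Z=(Z_1,\ldots,Z_N)$ with $Z_k\in\mathbb C^{n_k\times n_k}$; write $\bar Z$ for the tuple of entrywise complex conjugates. Let $$\Pi:=\{Z:\ Z_k+Z_k^*>0,\ k=1,\ldots,N\},\qquad \Omega_{n_1,\ldots,n_N}:=\bigcup_{|\lambda|=1}\lambda\,\Pi,\qquad \mathbb D:=\{W:\ W_kW_k^*<I_{n_k},\ k=1,\ldots,N\}.$$ An *anti-unitary involution* (AUI) on a Hilbert space $\mathcal U$ is a map $\iota:\mathcal U\to\mathcal U$ with $\iota^2=I_{\mathcal U}$ and $\langle\iota u,\iota v\rangle=\langle v,u\rangle$ for all $u,v$ (it is automatically anti-linear). Let $\iota_n$ be the entrywise complex conjugation on $\mathbb C^n$; for AUIs, $\iota_{\mathcal U}\oplus\iota_{\mathcal H}$ and $\iota_n\otimes\iota_{\mathcal M}$ are the induced AUIs on $\mathcal U\oplus\mathcal H$ and $\mathbb C^n\otimes\mathcal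 M$. An operator $A\in L(\mathcal U,\mathcal Y)$ is $(\iota_{\mathcal U},\iota_{\mathcal Y})$-*real* if $\iota_{\mathcal Y}A=A\iota_{\mathcal U}$. An $L(\mathcal U,\mathcal Y)$-valued function $g$ on a conjugation-invariant set $S$ of tuples is $(\iota_{\mathcal U},\iota_{\mathcal Y})$-*real* if $\iota_{\mathcal Y}\,g(\bar Z)\,\iota_{\mathcal U}=g(Z)$ for all $Z\in S$. If $\mathcal Y=\mathcal U$ and $\iota_{\mathcal Y}=\iota_{\mathcal U}=\iota$, one says $\iota$-real. A *long resolvent representation* of $f:\Omega_{n_1,\ldots,n_N}\to L(\mathcal U)$ consists of Hilbert spaces $\mathcal H,\mathcal M_1,\ldots,\mathcal M_N$ and operators $G_k\in L(\mathcal U\oplus\mathcal H,\mathbb C^{n_k}\otimes\mathcal M_k)$ such that, with $$A(Z)=\sum_{k=1}^N G_k^*(Z_k\otimes I_{\mathcal M_k})G_k=\begin{bmatrix}a(Z)&b(Z)\\ c(Z)&d(Z)\end{bmatrix}\in L(\mathcal U\oplus\mathcal H),$$ the operator $d(Z)$ is boundedly invertible and $f(Z)=a(Z)-b(Z)d(Z)^{-1}c(Z)$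 for all $Z\in\Omega_{n_1,\ldots,n_N}$. The *Bessmertnyĭ class* $\mathcal B_{n_1,\ldots,n_N}(\mathcal U)$ is the set of all holomorphic $f:\Omega_{n_1,\ldots,n_N}\to L(\mathcal U)$ that have a long resolvent representation. For $W\in\mathbb D$ put $Z(W)=\big((I+W_k)(I-W_k)^{-1}\big)_{k=1}^N\in\Pi$. The *double Cayley transform* of $f$ is $\mathcal C(f)(W)=[f(Z(W))-I_{\mathcal U}]\,[f(Z(W))+I_{\mathcal U}]^{-1}$, $W\in\mathbb D$; it is *defined* if $f(Z(W))+I_{\mathcal U}$ is boundedly invertible for every $W\in\mathbb D$. **Theorem.** Let $\iota=\iota_{\mathcal U}$ be an AUI on a Hilbert space $\mathcal U$, and let $f$ be a holomorphic $L(\mathcal U)$-valued function on $\Omega_{n_1,\ldots,n_N}$. The following statements are equivalent. (i) $f\in\mathcal B_{n_1,\ldots,n_N}(\mathcal U)$ and $f$ is $\iota$-real. (ii) There are a long resolvent representation of $f$ and AUIs $\iota_{\mathcal H}$ on $\mathcal H$ and $\iota_{\mathcal M_k}$ on $\mathcal M_k$ such that each $G_k$ is $(\iota_{\mathcal U}\oplus\iota_{\mathcal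 H},\ \iota_{n_k}\otimes\iota_{\mathcal M_k})$-real, $k=1,\ldots,N$. (iii) There are Hilbert spaces $\mathcal M_k$ with AUIs $\iota_{\mathcal M_k}$ and holomorphic functions $\varphi_k:\Pi\to L(\mathcal U,\mathbb C^{n_k}\otimes\mathcal M_k)$, each $(\iota_{\mathcal U},\iota_{n_k}\otimes\iota_{\mathcal M_k})$-real, $k=1,\ldots,N$, such that $$f(Z)=\sum_{k=1}^N\varphi_k(\Lambda)^*(Z_k\otimes I_{\mathcal M_k})\varphi_k(Z),\qquad Z,\Lambda\in\Pi.$$ (iv) $\mathcal F=\mathcal C(f)$ is defined, and there are a Hilbert space $\mathcal X$, an AUI $\iota_{\mathcal X}$ on $\mathcal X$ and an operator $$U=\begin{bmatrix}A&B\\ C&D\end{bmatrix}\in L\big((\mathbb C^{n_1+\cdots+n_N}\otimes\mathcal X)\oplus\mathcal U\big),\qquad U=U^*=U^{-1},$$ such that $U$ is $\big((\iota_{n_1+\cdots+n_N}\otimes\iota_{\mathcal X})\oplus\iota_{\mathcal U}\big)$-real and, with $P(W)=\operatorname{diag}(W_1,\ldots,W_N)$, $$\mathcal F(W)=D+C(P(W)\otimes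 I_{\mathcal X})\big(I-A(P(W)\otimes I_{\mathcal X})\big)^{-1}B,\qquad W\in\mathbb D.$$ -/

import Mathlib

open scoped Matrix ComplexOrder Matrix.Norms.L2Operator

universe u

namespace Bessmertnyi

noncomputable section

/-! ### Anti-unitary involutions and real operators -/

/-- An anti-unitary involution (AUI) on an inner product space: a map `ι` with `ι² = I` and
`⟨ι u, ι v⟩ = ⟨v, u⟩`. Anti-linearity is a consequence (`AUI.map_add`, `AUI.map_smul`). -/
structure AUI (E : Type*) [NormedAddCommGroup E] [InnerProductSpace ℂ E] where
  toFun : E → E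
  invol : ∀ x, toFun (toFun x) = x
  inner_map : ∀ x y, inner ℂ (toFun x) (toFun y) = inner ℂ y x

instance {E : Type*} [NormedAddCommGroup E] [InnerProductSpace ℂ E] :
    CoeFun (AUI E) (fun _ => E → E) := ⟨AUI.toFun⟩

section AUI

variable {E F : Type*} [NormedAddCommGroup E] [InnerProductSpace ℂ E]
  [NormedAddCommGroup F] [InnerProductSpace ℂ F]

theorem AUI.inner_left (ι : AUI E) (x y : E) : inner ℂ (ι x) y = inner ℂ (ι y) x := by
  have h := ι.inner_map x (ι y)
  rwa [ι.invol] at h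

theorem AUI.map_add (ι : AUI E) (x y : E) : ι (x + y) = ι x + ι y := by
  refine ext_inner_right ℂ fun v => ?_
  rw [inner_add_left, ι.inner_left, inner_add_right, ι.inner_left x, ι.inner_left y]

theorem AUI.map_smul (ι : AUI E) (c : ℂ) (x : E) : ι (c • x) = starRingEnd ℂ c • ι x := by
  refine ext_inner_right ℂ fun v => ?_
  rw [inner_smul_left, ι.inner_left, inner_smul_right, ι.inner_left x]
  simp

/-- The AUI `ι_E ⊕ ι_F` on the Hilbert direct sum `E ⊕ F`. -/
def AUI.prod (ι : AUI E) (κ : AUI F) : AUI (WithLp 2 (E × F)) where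
  toFun x := WithLp.toLp 2 (ι x.fst, κ x.snd)
  invol x := by
    apply (WithLp.equiv 2 (E × F)).injective
    simp [ι.invol, κ.invol]
    rfl
  inner_map x y := by
    simp [WithLp.prod_inner_apply, ι.inner_map, κ.inner_map]

/-- An operator `A ∈ L(E, F)` is `(ι_E, ι_F)`-real if `ι_F A = A ι_E`. -/
def IsRealOp (ι : AUI E) (κ : AUI F) (A : E →L[ℂ] F) : Prop :=
  ∀ x, κ (A x) = A (ι x)

end AUI

/-! ### The Hilbert space `ℂ^s ⊗ E` -/

section Tensor

variable {s : Type*} [Fintype s] {E : Type*} [NormedAddCommGroup E] [InnerProductSpace ℂ E]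

/-- The Hilbert space `ℂ^s ⊗ E` (for a finite index set `s`), realised as the Hilbert space of
columns `(x_i)_{i ∈ s}` with entries in `E`; the elementary tensors are `tmul v e = (v_i e)_i`. -/
abbrev Tensor (s : Type*) [Fintype s] (E : Type*) [NormedAddCommGroup E]
    [InnerProductSpace ℂ E] : Type _ :=
  PiLp 2 (fun _ : s => E)

/-- The elementary tensor `v ⊗ e`. -/
def tmul (v : s → ℂ) (e : E) : Tensor s E := WithLp.toLp 2 fun i => v i • e

theorem inner_tmul (v w : s → ℂ) (e e' : E) :
    inner ℂ (tmul v e) (tmul w e') = (∑ i, w i * starRingEnd ℂ (v i)) * inner ℂ e e' := by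
  simp only [tmul, PiLp.inner_apply, inner_smul_left, inner_smul_right, Finset.sum_mul]
  exact Finset.sum_congr rfl fun i _ => by ring

theorem eq_sum_tmul [DecidableEq s] (x : Tensor s E) :
    x = ∑ i, tmul (Pi.single i 1) (x i) := by
  ext j
  simp [tmul, Pi.single_apply]

/-- The operator `Z ⊗ I_E` on `ℂ^s ⊗ E`. -/
def ampl (Z : Matrix s s ℂ) : Tensor s E →L[ℂ] Tensor s E :=
  (PiLp.continuousLinearEquiv 2 ℂ (fun _ : s => E)).symm.toContinuousLinearMap ∘L
    ContinuousLinearMap.pi fun i => ∑ j, Z i j • PiLp.proj 2 (𝕜 := ℂ) (fun _ : s => E) j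

theorem ampl_apply (Z : Matrix s s ℂ) (x : Tensor s E) (i : s) :
    ampl Z x i = ∑ j, Z i j • x j := by
  simp [ampl]

theorem ampl_tmul (Z : Matrix s s ℂ) (v : s → ℂ) (e : E) :
    ampl Z (tmul v e) = tmul (Z *ᵥ v) e := by
  ext i
  simp [ampl_apply, tmul, Matrix.mulVec, dotProduct, Finset.sum_smul, smul_smul]

/-- The AUI `ι_s ⊗ ι_E` on `ℂ^s ⊗ E`, with `ι_s` the entrywise complex conjugation of `ℂ^s`. -/
def AUI.tensor (s : Type*) [Fintype s] (ι : AUI E) : AUI (Tensor s E) where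
  toFun x := WithLp.toLp 2 fun i => ι (x i)
  invol x := by
    ext i
    simp [ι.invol]
  inner_map x y := by
    simp [PiLp.inner_apply, ι.inner_map]

theorem AUI.tensor_tmul (ι : AUI E) (v : s → ℂ) (e : E) :
    AUI.tensor s ι (tmul v e) = tmul (star v) (ι e) := by
  ext i
  simp [AUI.tensor, tmul, ι.map_smul]

end Tensor

/-! ### Blocks of an operator on `E ⊕ F` -/

section Blocks

variable {E F : Type*} [NormedAddCommGroup E] [InnerProductSpace ℂ E]
  [NormedAddCommGroup F] [InnerProductSpace ℂ F]

/-- The embedding `E → E ⊕ F`. -/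
def inlL (E F : Type*) [NormedAddCommGroup E] [InnerProductSpace ℂ E]
    [NormedAddCommGroup F] [InnerProductSpace ℂ F] : E →L[ℂ] WithLp 2 (E × F) :=
  (WithLp.prodContinuousLinearEquiv 2 ℂ E F).symm.toContinuousLinearMap ∘L
    ContinuousLinearMap.inl ℂ E F

/-- The embedding `F → E ⊕ F`. -/
def inrL (E F : Type*) [NormedAddCommGroup E] [InnerProductSpace ℂ E]
    [NormedAddCommGroup F] [InnerProductSpace ℂ F] : F →L[ℂ] WithLp 2 (E × F) :=
  (WithLp.prodContinuousLinearEquiv 2 ℂ E F).symm.toContinuousLinearMap ∘L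
    ContinuousLinearMap.inr ℂ E F

/-- The upper left block. -/
def block11 (T : WithLp 2 (E × F) →L[ℂ] WithLp 2 (E × F)) : E →L[ℂ] E :=
  WithLp.fstL 2 ℂ E F ∘L T ∘L inlL E F

/-- The upper right block. -/
def block12 (T : WithLp 2 (E × F) →L[ℂ] WithLp 2 (E × F)) : F →L[ℂ] E :=
  WithLp.fstL 2 ℂ E F ∘L T ∘L inrL E F

/-- The lower left block. -/
def block21 (T : WithLp 2 (E × F) →L[ℂ] WithLp 2 (E × F)) : E →L[ℂ] F :=
  WithLp.sndL 2 ℂ E F ∘L T ∘L inlL E F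

/-- The lower right block. -/
def block22 (T : WithLp 2 (E × F) →L[ℂ] WithLp 2 (E × F)) : F →L[ℂ] F :=
  WithLp.sndL 2 ℂ E F ∘L T ∘L inrL E F

end Blocks

/-! ### Domains -/

section Domains

variable {N : ℕ} (n : Fin N → ℕ)

/-- Tuples `Z = (Z_1, …, Z_N)` of square complex matrices of sizes `n_1, …, n_N`. -/
abbrev Tuple : Type := ∀ k, Matrix (Fin (n k)) (Fin (n k)) ℂ

/-- The product of matrix halfplanes: `Z_k + Z_k^* > 0` for all `k`. -/
def halfplane : Set (Tuple n) := {Z | ∀ k, (Z k + (Z k)ᴴ).PosDef}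

/-- `Ω_{n_1,…,n_N}`: the union of the rotations `λ Π^{n_1×n_1} × ⋯ × λ Π^{n_N×n_N}`, `|λ| = 1`. -/
def Omega : Set (Tuple n) := {Z | ∃ c : ℂ, ‖c‖ = 1 ∧ ∃ Y ∈ halfplane n, Z = c • Y}

/-- The product of open matrix unit disks: `W_k W_k^* < I` for all `k`. -/
def disk : Set (Tuple n) := {W | ∀ k, (1 - W k * (W k)ᴴ).PosDef}

variable {n}

/-- The entrywise complex conjugate of a tuple of matrices. -/
def conjTuple (Z : Tuple n) : Tuple n := fun k => (Z k).map (starRingEnd ℂ)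

/-- The Cayley transform over the variables. -/
def cayley (W : Tuple n) : Tuple n := fun k => (1 + W k) * (1 - W k)⁻¹

/-- An `L(E, F)`-valued function `f` on a set `S` of tuples is `(ι_E, ι_F)`-real if
`ι_F f(conj Z) ι_E = f(Z)` for all `Z ∈ S`. -/
def IsRealFun {E F : Type*} [NormedAddCommGroup E] [InnerProductSpace ℂ E]
    [NormedAddCommGroup F] [InnerProductSpace ℂ F] (ι : AUI E) (κ : AUI F)
    (S : Set (Tuple n)) (f : Tuple n → E →L[ℂ] F) : Prop :=
  ∀ Z ∈ S, ∀ x, κ (f (conjTuple Z) (ι x)) = f Z x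

end Domains

/-! ### Representations -/

section Representations

variable {N : ℕ} {n : Fin N → ℕ}
  {U : Type*} [NormedAddCommGroup U] [InnerProductSpace ℂ U] [CompleteSpace U]
  {H : Type*} [NormedAddCommGroup H] [InnerProductSpace ℂ H] [CompleteSpace H]
  {M : Fin N → Type*} [∀ k, NormedAddCommGroup (M k)] [∀ k, InnerProductSpace ℂ (M k)]
  [∀ k, CompleteSpace (M k)]

/-- The pencil `A(Z) = ∑ G_k^* (Z_k ⊗ I) G_k` on `U ⊕ H`. -/
def pencil (G : ∀ k, WithLp 2 (U × H) →L[ℂ] Tensor (Fin (n k)) (M k)) (Z : Tuple n) :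
    WithLp 2 (U × H) →L[ℂ] WithLp 2 (U × H) :=
  ∑ k, ContinuousLinearMap.adjoint (G k) ∘L ampl (Z k) ∘L G k

/-- Long resolvent representation: for every `Z ∈ Ω`, with `a, b, c, d` the blocks of `A(Z)`,
the operator `d` is boundedly invertible and `f(Z) = a - b d⁻¹ c`. -/
def IsLongResolvent (f : Tuple n → U →L[ℂ] U)
    (G : ∀ k, WithLp 2 (U × H) →L[ℂ] Tensor (Fin (n k)) (M k)) : Prop :=
  ∀ Z ∈ Omega n, IsUnit (block22 (pencil G Z)) ∧
    f Z = block11 (pencil G Z) -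
      block12 (pencil G Z) ∘L Ring.inverse (block22 (pencil G Z)) ∘L block21 (pencil G Z)

/-- The functions `φ_k` are holomorphic on the product of halfplanes, and
`f(Z) = ∑ φ_k(Λ)^* (Z_k ⊗ I) φ_k(Z)` for all `Z, Λ` in it. -/
def IsDecomposition (f : Tuple n → U →L[ℂ] U)
    (φ : ∀ k, Tuple n → U →L[ℂ] Tensor (Fin (n k)) (M k)) : Prop :=
  (∀ k, DifferentiableOn ℂ (φ k) (halfplane n)) ∧
  ∀ Z ∈ halfplane n, ∀ Y ∈ halfplane n,
    f Z = ∑ k, ContinuousLinearMap.adjoint (φ k Y) ∘L ampl (Z k) ∘L φ k Z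

/-- The double Cayley transform of `f` is well defined on the product of disks. -/
def DoubleCayleyDefined (f : Tuple n → U →L[ℂ] U) : Prop :=
  ∀ W ∈ disk n, IsUnit (f (cayley W) + 1)

/-- The double Cayley transform `C(f)`. -/
def doubleCayley (f : Tuple n → U →L[ℂ] U) (W : Tuple n) : U →L[ℂ] U :=
  (f (cayley W) - 1) * Ring.inverse (f (cayley W) + 1)

/-- The index set of `ℂ^{n_1+⋯+n_N}`. -/
abbrev TotalIndex (n : Fin N → ℕ) : Type := Σ k, Fin (n k)

/-- `F(W) = D + C (P(W) ⊗ I) (I - A (P(W) ⊗ I))⁻¹ B` on the product of disks, with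
`T = [A B; C D]` and `P(W) = diag(W_1, …, W_N)`. -/
def IsRealization {X : Type*} [NormedAddCommGroup X] [InnerProductSpace ℂ X]
    (F : Tuple n → U →L[ℂ] U)
    (T : WithLp 2 (Tensor (TotalIndex n) X × U) →L[ℂ] WithLp 2 (Tensor (TotalIndex n) X × U)) :
    Prop :=
  ∀ W ∈ disk n, IsUnit (1 - block11 T ∘L ampl (Matrix.blockDiagonal' W)) ∧
    F W = block22 T + block21 T ∘L ampl (Matrix.blockDiagonal' W) ∘L
      Ring.inverse (1 - block11 T ∘L ampl (Matrix.blockDiagonal' W)) ∘L block12 T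

end Representations

/-! ### The Bessmertnyĭ class -/

/-- `f` belongs to the class `B_{n_1,…,n_N}(U)`: it is holomorphic on `Ω` and has a long
resolvent representation there. -/
def MemBessmertnyi {N : ℕ} (n : Fin N → ℕ) (U : Type u) [NormedAddCommGroup U]
    [InnerProductSpace ℂ U] [CompleteSpace U] (f : Tuple n → U →L[ℂ] U) : Prop :=
  DifferentiableOn ℂ f (Omega n) ∧
  ∃ (H : Type u) (_ : NormedAddCommGroup H) (_ : InnerProductSpace ℂ H) (_ : CompleteSpace H)
    (M : Fin N → Type u) (_ : ∀ k, NormedAddCommGroup (M k))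
    (_ : ∀ k, InnerProductSpace ℂ (M k)) (_ : ∀ k, CompleteSpace (M k))
    (G : ∀ k, WithLp 2 (U × H) →L[ℂ] Tensor (Fin (n k)) (M k)),
    IsLongResolvent f G

end

end Bessmertnyi

/-!
All four statements are equivalent to the existence of a single real factorization
`f(Z) = Φ(Λ)^* P(Z) Φ(Z)`, `P(Z) = diag(Z₁, …, Z_N) ⊗ I`, on the product of halfplanes.

Eliminating the second component of a long resolvent representation gives `Φ`. Conversely, let
`H` be the space of vectors orthogonal to every `P(Z) Φ(Z) x`, and put `G (x, h) = Φ(1) x + h` on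
`U ⊕ H`. Then `G^* P(Z) Φ(Z) x = (f(Z) x, 0)`; since the differences `Φ(Z) x - Φ(1) x` lie in `H`,
the vector `Φ(Z) x` is in the range of `G`, and `f(Z)` is the Schur complement of `G^* P(Z) G`.

The factorization also says that the vectors `(P(Z) Φ(Z) x, f(Z) x)` are orthogonal to the vectors
`(-Φ(Λ) y, y)`. The reflection that negates the span of the latter is the unitary of the
realization, because the Cayley transforms of `Z` and `f` turn the eigenspaces of a selfadjoint
involution `[A B; C D]` into the input-output relation of the corresponding system.

If `f` is real, the normalized direct sum of `Φ` and its conjugate is real for the conjugation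
that swaps the two summands.
-/

namespace Bessmertnyi

noncomputable section

open scoped MatrixOrder
open ContinuousLinearMap (adjoint)

section CStarAlgebra

variable {A B : Type*} [CStarAlgebra A] [PartialOrder A] [StarOrderedRing A]
  [CStarAlgebra B] [PartialOrder B] [StarOrderedRing B]

theorem isStrictlyPositive_map (φ : A →⋆ₐ[ℂ] B) {a : A} (ha : IsStrictlyPositive a) :
    IsStrictlyPositive (φ a) :=
  (ha.isUnit.map φ).isStrictlyPositive (map_nonneg φ ha.nonneg)

theorem exists_algebraMap_le_of_isStrictlyPositive {a : A} (ha : IsStrictlyPositive a) :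
    ∃ ε : ℝ, 0 < ε ∧ algebraMap ℝ A ε ≤ a := by
  cases subsingleton_or_nontrivial A
  · exact ⟨1, one_pos, (Subsingleton.elim _ _).le⟩
  · exact (CFC.exists_pos_algebraMap_le_iff ha.isSelfAdjoint).2 fun _ hx => ha.spectrum_pos hx

theorem norm_lt_one_of_isStrictlyPositive {a : A} (ha : IsStrictlyPositive (1 - a * star a)) :
    ‖a‖ < 1 := by
  obtain ⟨ε, hε, h⟩ := exists_algebraMap_le_of_isStrictlyPositive ha
  have hle : a * star a ≤ algebraMap ℝ A (max (1 - ε) 0) := calc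
    a * star a ≤ 1 - algebraMap ℝ A ε := le_sub_comm.1 h
    _ = algebraMap ℝ A (1 - ε) := by rw [map_sub, map_one]
    _ ≤ algebraMap ℝ A (max (1 - ε) 0) := by gcongr; exact le_max_left _ _
  have hnorm : ‖a‖ * ‖a‖ ≤ max (1 - ε) 0 := by
    rw [← CStarRing.norm_self_mul_star]
    exact (CStarAlgebra.norm_le_iff_le_algebraMap _ (le_max_right _ _)).2 hle
  have : max (1 - ε) 0 < 1 := max_lt (by linarith) one_pos
  nlinarith [norm_nonneg a]

/-- For small `t > 0` the element `1 - t a` is a strict contraction, so `t a` is invertible. -/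
theorem isUnit_of_isStrictlyPositive_add_star {a : A} (ha : IsStrictlyPositive (a + star a)) :
    IsUnit a := by
  obtain ⟨ε, hε, h⟩ := exists_algebraMap_le_of_isStrictlyPositive ha
  obtain ⟨t, ht, htε⟩ : ∃ t : ℝ, 0 < t ∧ t * ‖a‖ ^ 2 < ε :=
    ⟨ε / (‖a‖ ^ 2 + 1), by positivity, by
      rw [div_mul_eq_mul_div, div_lt_iff₀ (by positivity)]; nlinarith [sq_nonneg ‖a‖]⟩
  have hsq : a * star a ≤ algebraMap ℝ A (‖a‖ ^ 2) := by
    rw [sq, ← CStarRing.norm_self_mul_star]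
    exact (mul_star_self_nonneg a).isSelfAdjoint.le_algebraMap_norm_self
  have hpos : IsStrictlyPositive (1 - (1 - t • a) * star (1 - t • a)) := by
    refine IsStrictlyPositive.of_le
      (isStrictlyPositive_algebraMap (mul_pos ht (sub_pos.2 htε))) ?_
    calc algebraMap ℝ A (t * (ε - t * ‖a‖ ^ 2))
        = t • algebraMap ℝ A ε - t ^ 2 • algebraMap ℝ A (‖a‖ ^ 2) := by
          simp only [Algebra.algebraMap_eq_smul_one, smul_smul, ← sub_smul]
          ring_nf
      _ ≤ t • (a + star a) - t ^ 2 • (a * star a) := by gcongr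
      _ = 1 - (1 - t • a) * star (1 - t • a) := by
          simp only [star_sub, star_one, star_smul, star_trivial, sub_mul, mul_sub, one_mul,
            mul_one, smul_mul_smul_comm, smul_add, sq]
          abel
  have hunit := isUnit_one_sub_of_norm_lt_one (norm_lt_one_of_isStrictlyPositive hpos)
  rw [sub_sub_cancel] at hunit
  have hscale := hunit.smul (Units.mk0 t⁻¹ (inv_ne_zero ht.ne'))
  rwa [Units.smul_def, Units.val_mk0, inv_smul_smul₀ ht.ne'] at hscale

theorem isStrictlyPositive_two_smul_iff {a : A} :
    IsStrictlyPositive ((2 : ℝ) • a) ↔ IsStrictlyPositive a :=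
  ⟨fun h => by simpa using IsStrictlyPositive.smul (c := (2 : ℝ)⁻¹) (by positivity) h,
    fun h => h.smul two_pos⟩

/-- Both conditions are intertwined by the congruence
`(1 - w) (z + z⋆) (1 - w)⋆ = 2 (1 - w w⋆)`. -/
theorem isStrictlyPositive_add_star_iff_of_cayley {w z : A} (hw : IsUnit (1 - w))
    (h : z * (1 - w) = 1 + w) :
    IsStrictlyPositive (z + star z) ↔ IsStrictlyPositive (1 - w * star w) := by
  have h' : (1 - w) * z = 1 + w := hw.mul_right_cancel <| by rw [mul_assoc, h]; noncomm_ring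
  have key : (1 - w) * (z + star z) * star (1 - w) = (2 : ℝ) • (1 - w * star w) := calc
    _ = (1 - w) * z * star (1 - w) + (1 - w) * star ((1 - w) * z) := by
      rw [star_mul]; noncomm_ring
    _ = (2 : ℝ) • (1 - w * star w) := by
      rw [h', two_smul]
      simp only [star_sub, star_add, star_one]
      noncomm_ring
  rw [← hw.isStrictlyPositive_star_right_conjugate_iff, key, isStrictlyPositive_two_smul_iff]

theorem isUnit_one_sub_of_isStrictlyPositive {w : A}
    (hw : IsStrictlyPositive (1 - w * star w)) : IsUnit (1 - w) :=
  isUnit_one_sub_of_norm_lt_one (norm_lt_one_of_isStrictlyPositive hw)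

theorem isUnit_add_one_of_add_star_nonneg {z : A} (hz : 0 ≤ z + star z) : IsUnit (z + 1) := by
  refine isUnit_of_isStrictlyPositive_add_star ?_
  have hsum : z + 1 + star (z + 1) = z + star z + (2 : ℝ) • (1 : A) := by
    rw [star_add, star_one, two_smul]; abel
  rw [hsum]
  exact .nonneg_add hz (.smul two_pos isStrictlyPositive_one)

theorem exists_mul_one_sub_eq_one_add {z : A}
    (hz : IsStrictlyPositive (z + star z)) :
    ∃ w : A, IsStrictlyPositive (1 - w * star w) ∧ z * (1 - w) = 1 + w := by
  have hz1 : IsUnit (z + 1) := isUnit_add_one_of_add_star_nonneg hz.nonneg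
  obtain ⟨w, hw⟩ : ∃ w : A, w * (z + 1) = z - 1 :=
    ⟨(z - 1) * Ring.inverse (z + 1), by rw [mul_assoc, Ring.inverse_mul_cancel _ hz1, mul_one]⟩
  have hcancel : (1 - w) * (z + 1) = (2 : ℝ) • 1 := by
    rw [sub_mul, hw, two_smul]; noncomm_ring
  have hw1 : IsUnit (1 - w) := by
    have h2 : IsUnit ((2 : ℝ) • (1 : A)) := (isStrictlyPositive_one.smul two_pos).isUnit
    rw [← hcancel] at h2
    exact hz1.unit.isUnit_mul_units (1 - w) |>.1 h2
  have hzw : z * (1 - w) = 1 + w := hz1.mul_right_cancel <| by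
    rw [mul_assoc, hcancel, add_mul, hw, two_smul]; noncomm_ring
  exact ⟨w, (isStrictlyPositive_add_star_iff_of_cayley hw1 hzw).1 hz, hzw⟩

end CStarAlgebra

section AUI

variable {E F : Type*} [NormedAddCommGroup E] [InnerProductSpace ℂ E]
  [NormedAddCommGroup F] [InnerProductSpace ℂ F]

/-- An anti-unitary involution as an antilinear isometric equivalence; this gives access to the
library's lemmas on semilinear maps. -/
def AUI.toLinearIsometryEquiv (ι : AUI E) : E ≃ₗᵢ⋆[ℂ] E where
  toFun := ι
  map_add' := ι.map_add
  map_smul' := ι.map_smul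
  invFun := ι
  left_inv := ι.invol
  right_inv := ι.invol
  norm_map' x := by
    change ‖ι x‖ = ‖x‖
    rw [norm_eq_sqrt_re_inner (𝕜 := ℂ), norm_eq_sqrt_re_inner (𝕜 := ℂ), ι.inner_map]

theorem AUI.map_zero (ι : AUI E) : ι 0 = 0 :=
  _root_.map_zero ι.toLinearIsometryEquiv

theorem AUI.map_neg (ι : AUI E) (x : E) : ι (-x) = -ι x :=
  _root_.map_neg ι.toLinearIsometryEquiv x

theorem AUI.map_sum (ι : AUI E) {α : Type*} (s : Finset α) (g : α → E) :
    ι (∑ i ∈ s, g i) = ∑ i ∈ s, ι (g i) :=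
  _root_.map_sum ι.toLinearIsometryEquiv g s

/-- The conjugate `κ A ι` of an operator `A`; an operator is real if it is its own conjugate. -/
def AUI.conj (ι : AUI E) (κ : AUI F) (A : E →L[ℂ] F) : E →L[ℂ] F :=
  (κ.toLinearIsometryEquiv : F →SL[starRingEnd ℂ] F) ∘SL A ∘SL
    (ι.toLinearIsometryEquiv : E →SL[starRingEnd ℂ] E)

theorem AUI.conj_apply (ι : AUI E) (κ : AUI F) (A : E →L[ℂ] F) (x : E) :
    ι.conj κ A x = κ (A (ι x)) := rfl

/-- The restriction of an anti-unitary involution to an invariant subspace. -/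
def AUI.restrict (ι : AUI E) (S : Submodule ℂ E) (hS : ∀ x ∈ S, ι x ∈ S) : AUI S where
  toFun x := ⟨ι x, hS x x.2⟩
  invol x := Subtype.ext (ι.invol x)
  inner_map x y := ι.inner_map x y

/-- The anti-unitary involution `(x, y) ↦ (ι y, ι x)` on `E ⊕ E`. -/
def AUI.swap (ι : AUI E) : AUI (WithLp 2 (E × E)) where
  toFun x := WithLp.toLp 2 (ι x.snd, ι x.fst)
  invol x := (WithLp.equiv 2 (E × E)).injective <| Prod.ext (ι.invol x.fst) (ι.invol x.snd)
  inner_map x y := by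
    simp [WithLp.prod_inner_apply, ι.inner_map, add_comm]

/-- The entrywise anti-unitary involution on a finite Hilbert direct sum. -/
def AUI.pi {κ : Type*} [Fintype κ] {M : κ → Type*} [∀ k, NormedAddCommGroup (M k)]
    [∀ k, InnerProductSpace ℂ (M k)] (ι : ∀ k, AUI (M k)) : AUI (PiLp 2 M) where
  toFun x := WithLp.toLp 2 fun k => ι k (x k)
  invol x := by
    ext k
    simp [(ι k).invol]
  inner_map x y := by
    simp [PiLp.inner_apply, (ι _).inner_map]

theorem AUI.nonempty (E : Type*) [NormedAddCommGroup E] [InnerProductSpace ℂ E]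
    [CompleteSpace E] : Nonempty (AUI E) := by
  obtain ⟨w, b, -⟩ := exists_hilbertBasis ℂ E
  refine ⟨⟨fun x => b.repr.symm (star (b.repr x)), fun x => by simp, fun x y => ?_⟩⟩
  rw [← b.repr.inner_map_map, LinearIsometryEquiv.apply_symm_apply,
    LinearIsometryEquiv.apply_symm_apply, ← b.repr.inner_map_map y x, lp.inner_eq_tsum,
    lp.inner_eq_tsum]
  exact tsum_congr fun i => by simp [lp.star_apply, mul_comm]

theorem AUI.mem_span (ι : AUI E) {s : Set E} (hs : ∀ x ∈ s, ι x ∈ s) {x : E}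
    (hx : x ∈ Submodule.span ℂ s) : ι x ∈ Submodule.span ℂ s := by
  induction hx using Submodule.span_induction with
  | mem x hx => exact Submodule.subset_span (hs x hx)
  | zero => exact ι.map_zero.symm ▸ zero_mem _
  | add x y _ _ hx hy => exact (ι.map_add x y).symm ▸ add_mem hx hy
  | smul c x _ hx => exact (ι.map_smul c x).symm ▸ Submodule.smul_mem _ _ hx

theorem AUI.mem_orthogonal (ι : AUI E) {S : Submodule ℂ E} (hS : ∀ x ∈ S, ι x ∈ S) {x : E}
    (hx : x ∈ Sᗮ) : ι x ∈ Sᗮ := fun y hy => by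
  rw [inner_eq_zero_symm, ι.inner_left]
  exact hx _ (hS y hy)

theorem IsRealOp.adjoint [CompleteSpace E] [CompleteSpace F] {ι : AUI E} {κ : AUI F}
    {A : E →L[ℂ] F} (hA : IsRealOp ι κ A) : IsRealOp κ ι (adjoint A) := fun y => by
  refine ext_inner_right ℂ fun x => ?_
  rw [ι.inner_left, ContinuousLinearMap.adjoint_inner_right, ContinuousLinearMap.adjoint_inner_left,
    ← hA, κ.inner_left]

theorem isRealFun_iff {N : ℕ} {n : Fin N → ℕ} {ι : AUI E} {κ : AUI F} {S : Set (Tuple n)}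
    {f : Tuple n → E →L[ℂ] F} :
    IsRealFun ι κ S f ↔ ∀ Z ∈ S, ∀ x, f (conjTuple Z) (ι x) = κ (f Z x) :=
  forall₃_congr fun _ _ _ => ⟨fun h => by rw [← h, κ.invol], fun h => by rw [h, κ.invol]⟩

end AUI

section Amplification

variable {s : Type*} [Fintype s] {E : Type*} [NormedAddCommGroup E] [InnerProductSpace ℂ E]

theorem AUI.tensor_ampl (ι : AUI E) (Z : Matrix s s ℂ) (x : Tensor s E) :
    AUI.tensor s ι (ampl Z x) = ampl (Z.map (starRingEnd ℂ)) (AUI.tensor s ι x) := by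
  ext i
  simp only [AUI.tensor, ampl_apply, ι.map_sum, ι.map_smul, Matrix.map_apply]

variable [CompleteSpace E]

theorem adjoint_ampl (Z : Matrix s s ℂ) :
    adjoint (ampl Z : Tensor s E →L[ℂ] Tensor s E) = ampl Zᴴ := by
  symm
  refine (ContinuousLinearMap.eq_adjoint_iff _ _).2 fun x y => ?_
  simp only [PiLp.inner_apply, ampl_apply, sum_inner, inner_sum, inner_smul_left,
    inner_smul_right, Matrix.conjTranspose_apply, starRingEnd_apply, star_star]
  exact Finset.sum_comm

variable (E)

/-- The amplification `Z ↦ Z ⊗ I` as a homomorphism of star algebras. -/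
def amplHom [DecidableEq s] : Matrix s s ℂ →⋆ₐ[ℂ] (Tensor s E →L[ℂ] Tensor s E) where
  toFun := ampl
  map_one' := by
    ext x i
    simp [ampl_apply, Matrix.one_apply]
  map_mul' Z Y := by
    ext x i
    simp only [ampl_apply, mul_apply_eq_comp, Matrix.mul_apply, Finset.sum_smul,
      Finset.smul_sum, smul_smul]
    exact Finset.sum_comm
  map_zero' := by
    ext x i
    simp [ampl_apply]
  map_add' Z Y := by
    ext x i
    simp [ampl_apply, add_smul, Finset.sum_add_distrib]
  commutes' c := by
    ext x i
    simp [ampl_apply, Matrix.algebraMap_matrix_apply, ite_smul]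
  map_star' Z := (adjoint_ampl Z).symm

theorem differentiable_ampl :
    Differentiable ℂ (ampl : Matrix s s ℂ → Tensor s E →L[ℂ] Tensor s E) := by
  classical exact
    (LinearMap.toContinuousLinearMap (amplHom (s := s) E).toAlgHom.toLinearMap).differentiable

end Amplification

section Tuples

variable {N : ℕ} {n : Fin N → ℕ}

/-- The representation `Z ↦ diag(Z₁, …, Z_N) ⊗ I` of the C⋆-algebra of tuples of matrices. -/
def diagHom (n : Fin N → ℕ) (X : Type*) [NormedAddCommGroup X] [InnerProductSpace ℂ X]
    [CompleteSpace X] : Tuple n →⋆ₐ[ℂ] (Tensor (TotalIndex n) X →L[ℂ] Tensor (TotalIndex n) X) :=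
  (amplHom X).comp
    { toFun := fun Z => Matrix.blockDiagonal' Z
      map_one' := Matrix.blockDiagonal'_one
      map_mul' := fun Z Y => Matrix.blockDiagonal'_mul Z Y
      map_zero' := Matrix.blockDiagonal'_zero
      map_add' := fun Z Y => Matrix.blockDiagonal'_add Z Y
      commutes' := fun c => by
        simp only [Algebra.algebraMap_eq_smul_one, ← Matrix.blockDiagonal'_one,
          ← Matrix.blockDiagonal'_smul]
      map_star' := fun Z => (Matrix.blockDiagonal'_conjTranspose Z).symm }

theorem isStrictlyPositive_tuple_iff {Z : Tuple n} :
    IsStrictlyPositive Z ↔ ∀ k, (Z k).PosDef := by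
  simp only [← Matrix.isStrictlyPositive_iff_posDef, IsStrictlyPositive.iff_of_unital,
    Pi.isUnit_iff, forall_and, Pi.le_def, Pi.zero_apply]

theorem mem_halfplane_iff {Z : Tuple n} :
    Z ∈ halfplane n ↔ IsStrictlyPositive (Z + star Z) :=
  isStrictlyPositive_tuple_iff.symm

theorem mem_disk_iff {W : Tuple n} : W ∈ disk n ↔ IsStrictlyPositive (1 - W * star W) :=
  isStrictlyPositive_tuple_iff.symm

theorem cayley_mul_one_sub {W : Tuple n} (hW : W ∈ disk n) : cayley W * (1 - W) = 1 + W := by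
  funext k
  have hk : IsUnit (1 - W k) :=
    Pi.isUnit_iff.1 (isUnit_one_sub_of_isStrictlyPositive (mem_disk_iff.1 hW)) k
  exact Matrix.nonsing_inv_mul_cancel_right _ _ ((Matrix.isUnit_iff_isUnit_det _).1 hk)

theorem cayley_mem_halfplane {W : Tuple n} (hW : W ∈ disk n) : cayley W ∈ halfplane n :=
  mem_halfplane_iff.2 <| (isStrictlyPositive_add_star_iff_of_cayley
    (isUnit_one_sub_of_isStrictlyPositive (mem_disk_iff.1 hW)) (cayley_mul_one_sub hW)).2
    (mem_disk_iff.1 hW)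

theorem exists_mem_disk_cayley_eq {Z : Tuple n} (hZ : Z ∈ halfplane n) :
    ∃ W ∈ disk n, cayley W = Z := by
  obtain ⟨W, hW, h⟩ := exists_mul_one_sub_eq_one_add (mem_halfplane_iff.1 hZ)
  exact ⟨W, mem_disk_iff.2 hW, (isUnit_one_sub_of_isStrictlyPositive hW).mul_right_cancel <|
    (cayley_mul_one_sub (mem_disk_iff.2 hW)).trans h.symm⟩

theorem halfplane_subset_Omega : halfplane n ⊆ Omega n :=
  fun Z hZ => ⟨1, norm_one, Z, hZ, (one_smul ℂ Z).symm⟩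

theorem one_mem_halfplane : (1 : Tuple n) ∈ halfplane n := by
  rw [mem_halfplane_iff, star_one]
  exact .add_nonneg isStrictlyPositive_one zero_le_one

theorem smul_mem_halfplane {r : ℝ} (hr : 0 < r) {Z : Tuple n} (hZ : Z ∈ halfplane n) :
    r • Z ∈ halfplane n := by
  rw [mem_halfplane_iff] at hZ ⊢
  simpa [smul_add] using hZ.smul hr

theorem smul_mem_Omega {c : ℂ} (hc : c ≠ 0) {Z : Tuple n} (hZ : Z ∈ halfplane n) :
    c • Z ∈ Omega n := by
  refine ⟨c / ‖c‖, by simp [hc], ‖c‖ • Z, smul_mem_halfplane (norm_pos_iff.2 hc) hZ, ?_⟩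
  rw [← Complex.coe_smul, smul_smul, div_mul_cancel₀]
  simpa using hc

theorem conjTuple_smul (c : ℂ) (Z : Tuple n) :
    conjTuple (c • Z) = starRingEnd ℂ c • conjTuple Z := by
  ext k i j
  simp [conjTuple]

theorem conjTuple_conjTuple (Z : Tuple n) : conjTuple (conjTuple Z) = Z := by
  ext k i j
  simp [conjTuple]

theorem conjTuple_one : conjTuple (1 : Tuple n) = 1 := by
  ext k i j
  simp [conjTuple, Matrix.one_apply, apply_ite]

theorem conjTuple_mem_halfplane {Z : Tuple n} (hZ : Z ∈ halfplane n) :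
    conjTuple Z ∈ halfplane n := fun k => by
  have h : conjTuple Z k + (conjTuple Z k)ᴴ = (Z k + (Z k)ᴴ)ᵀ := by
    ext i j
    simp [conjTuple, add_comm]
  rw [h]
  exact (hZ k).transpose

theorem conjTuple_mem_Omega {Z : Tuple n} (hZ : Z ∈ Omega n) : conjTuple Z ∈ Omega n := by
  obtain ⟨c, hc, Y, hY, rfl⟩ := hZ
  exact ⟨starRingEnd ℂ c, by simpa using hc, conjTuple Y, conjTuple_mem_halfplane hY,
    conjTuple_smul c Y⟩

theorem AUI.tensor_diagHom {X : Type*} [NormedAddCommGroup X] [InnerProductSpace ℂ X]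
    [CompleteSpace X] (ι : AUI X) (Z : Tuple n) (x : Tensor (TotalIndex n) X) :
    AUI.tensor (TotalIndex n) ι (diagHom n X Z x) =
      diagHom n X (conjTuple Z) (AUI.tensor (TotalIndex n) ι x) := by
  change AUI.tensor _ ι (ampl (Matrix.blockDiagonal' Z) x) =
    ampl (Matrix.blockDiagonal' (conjTuple Z)) _
  rw [ι.tensor_ampl, Matrix.blockDiagonal'_map _ _ (_root_.map_zero _)]
  rfl

section DiagHom

variable {X : Type*} [NormedAddCommGroup X] [InnerProductSpace ℂ X] [CompleteSpace X]

theorem isStrictlyPositive_diagHom_add_star {Z : Tuple n} (hZ : Z ∈ halfplane n) :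
    IsStrictlyPositive (diagHom n X Z + star (diagHom n X Z)) := by
  simpa only [map_add, map_star] using
    isStrictlyPositive_map (diagHom n X) (mem_halfplane_iff.1 hZ)

theorem norm_diagHom_lt_one {W : Tuple n} (hW : W ∈ disk n) : ‖diagHom n X W‖ < 1 := by
  have h := isStrictlyPositive_map (diagHom n X) (mem_disk_iff.1 hW)
  rw [map_sub, map_one, map_mul, map_star] at h
  exact norm_lt_one_of_isStrictlyPositive h

theorem diagHom_cayley_mul_one_sub {W : Tuple n} (hW : W ∈ disk n) :
    diagHom n X (cayley W) * (1 - diagHom n X W) = 1 + diagHom n X W := by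
  rw [← map_one (diagHom n X), ← map_sub, ← map_add, ← map_mul, cayley_mul_one_sub hW]

end DiagHom

end Tuples

section SchurComplement

variable {E F : Type*} [NormedAddCommGroup E] [InnerProductSpace ℂ E]
  [NormedAddCommGroup F] [InnerProductSpace ℂ F]
  {T T' : WithLp 2 (E × F) →L[ℂ] WithLp 2 (E × F)}

theorem inverse_apply_apply {A : E →L[ℂ] E} (hA : IsUnit A) (x : E) :
    Ring.inverse A (A x) = x :=
  congrArg (· x) (Ring.inverse_mul_cancel A hA)

theorem apply_inverse_apply {A : E →L[ℂ] E} (hA : IsUnit A) (x : E) :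
    A (Ring.inverse A x) = x :=
  congrArg (· x) (Ring.mul_inverse_cancel A hA)

theorem inlL_apply_add_inrL_apply (x : E) (y : F) :
    inlL E F x + inrL E F y = WithLp.toLp 2 (x, y) := by
  simp [inlL, inrL, ← WithLp.toLp_add]

theorem apply_toLp (T : WithLp 2 (E × F) →L[ℂ] WithLp 2 (E × F)) (x : E) (y : F) :
    T (WithLp.toLp 2 (x, y)) =
      WithLp.toLp 2 (block11 T x + block12 T y, block21 T x + block22 T y) := by
  rw [← inlL_apply_add_inrL_apply, map_add]
  rfl

/-- The Schur complement `a - b d⁻¹ c` of `d` in `T = [a b; c d]`. -/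
def schurComplement (T : WithLp 2 (E × F) →L[ℂ] WithLp 2 (E × F)) : E →L[ℂ] E :=
  block11 T - block12 T ∘L Ring.inverse (block22 T) ∘L block21 T

/-- The column `[1; -d⁻¹ c]` of `T = [a b; c d]`, which solves `T v = (y, 0)`. -/
def schurColumn (T : WithLp 2 (E × F) →L[ℂ] WithLp 2 (E × F)) : E →L[ℂ] WithLp 2 (E × F) :=
  inlL E F - inrL E F ∘L Ring.inverse (block22 T) ∘L block21 T

theorem schurColumn_apply (T : WithLp 2 (E × F) →L[ℂ] WithLp 2 (E × F)) (x : E) :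
    schurColumn T x = WithLp.toLp 2 (x, -Ring.inverse (block22 T) (block21 T x)) := by
  rw [← inlL_apply_add_inrL_apply, map_neg, ← sub_eq_add_neg]
  rfl

theorem apply_schurColumn (hT : IsUnit (block22 T)) (x : E) :
    T (schurColumn T x) = WithLp.toLp 2 (schurComplement T x, 0) := by
  rw [schurColumn_apply, apply_toLp]
  simp [apply_inverse_apply hT, schurComplement, sub_eq_add_neg]

theorem schurColumn_apply_eq (hT : IsUnit (block22 T)) {x z : E} {y : F}
    (h : T (WithLp.toLp 2 (x, y)) = WithLp.toLp 2 (z, 0)) :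
    schurColumn T x = WithLp.toLp 2 (x, y) := by
  have hsnd : block21 T x + block22 T y = 0 := by
    rw [apply_toLp] at h
    exact congrArg WithLp.snd h
  rw [schurColumn_apply, eq_neg_of_add_eq_zero_left hsnd, map_neg, neg_neg,
    inverse_apply_apply hT]

theorem schurComplement_apply_eq (hT : IsUnit (block22 T)) {x z : E} {y : F}
    (h : T (WithLp.toLp 2 (x, y)) = WithLp.toLp 2 (z, 0)) : schurComplement T x = z := by
  rw [← schurColumn_apply_eq hT h, apply_schurColumn hT] at h
  exact congrArg WithLp.fst h

theorem isUnit_block22_smul (hT : IsUnit (block22 T)) {c : ℂ} (hc : c ≠ 0) :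
    IsUnit (block22 (c • T)) := by
  have h : block22 (c • T) = c • block22 T := by
    simp [block22]
  rw [h]
  exact hT.smul (Units.mk0 c hc)

theorem schurComplement_smul (hT : IsUnit (block22 T)) {c : ℂ} (hc : c ≠ 0) :
    schurComplement (c • T) = c • schurComplement T := by
  ext x
  refine schurComplement_apply_eq (isUnit_block22_smul hT hc)
    (y := -Ring.inverse (block22 T) (block21 T x)) ?_
  rw [smul_apply, ← schurColumn_apply, apply_schurColumn hT, ← WithLp.toLp_smul, Prod.smul_mk,
    smul_zero, smul_apply]

theorem differentiableAt_schurColumn [CompleteSpace F] {V : Type*} [NormedAddCommGroup V]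
    [NormedSpace ℂ V] {T : V → WithLp 2 (E × F) →L[ℂ] WithLp 2 (E × F)} {z : V}
    (hT : DifferentiableAt ℂ T z) (hz : IsUnit (block22 (T z))) :
    DifferentiableAt ℂ (fun v => schurColumn (T v)) z := by
  have h22 : DifferentiableAt ℂ (fun v => block22 (T v)) z := by
    unfold block22; fun_prop
  have h21 : DifferentiableAt ℂ (fun v => block21 (T v)) z := by
    unfold block21; fun_prop
  have hinv : DifferentiableAt ℂ (fun v => Ring.inverse (block22 (T v))) z :=
    DifferentiableAt.comp (g := Ring.inverse) z (differentiableAt_inverse hz) h22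
  exact ((differentiableAt_const (inrL E F)).clm_comp (hinv.clm_comp h21)).const_sub (inlL E F)

variable {ι : AUI E} {κ : AUI F}

theorem apply_prod_schurColumn (hT : IsUnit (block22 T))
    (h : ∀ v, T' (ι.prod κ v) = ι.prod κ (T v)) (x : E) :
    T' (WithLp.toLp 2 (ι x, κ (-Ring.inverse (block22 T) (block21 T x)))) =
      WithLp.toLp 2 (ι (schurComplement T x), 0) := by
  have hx := h (schurColumn T x)
  rw [apply_schurColumn hT, schurColumn_apply] at hx
  exact hx.trans (congrArg (fun y => WithLp.toLp 2 (_, y)) κ.map_zero)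

theorem schurColumn_prod (hT : IsUnit (block22 T)) (hT' : IsUnit (block22 T'))
    (h : ∀ v, T' (ι.prod κ v) = ι.prod κ (T v)) (x : E) :
    schurColumn T' (ι x) = ι.prod κ (schurColumn T x) := by
  rw [schurColumn_apply_eq hT' (apply_prod_schurColumn hT h x), schurColumn_apply]
  rfl

theorem schurComplement_prod (hT : IsUnit (block22 T)) (hT' : IsUnit (block22 T'))
    (h : ∀ v, T' (ι.prod κ v) = ι.prod κ (T v)) (x : E) :
    schurComplement T' (ι x) = ι (schurComplement T x) :=
  schurComplement_apply_eq hT' (apply_prod_schurColumn hT h x)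

end SchurComplement

section DirectSum

variable {N : ℕ} {n : Fin N → ℕ}
  {U V : Type*} [NormedAddCommGroup U] [InnerProductSpace ℂ U]
  [NormedAddCommGroup V] [InnerProductSpace ℂ V]
  {X : Type*} [NormedAddCommGroup X] [InnerProductSpace ℂ X] [CompleteSpace X]
  {M : Fin N → Type*} [∀ k, NormedAddCommGroup (M k)] [∀ k, InnerProductSpace ℂ (M k)]

theorem diagHom_apply (Z : Tuple n) (x : Tensor (TotalIndex n) X) (k : Fin N) (i : Fin (n k)) :
    diagHom n X Z x ⟨k, i⟩ = ∑ j, Z k i j • x ⟨k, j⟩ := by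
  change ampl (Matrix.blockDiagonal' Z) x ⟨k, i⟩ = _
  rw [ampl_apply, Fintype.sum_sigma, Finset.sum_eq_single k]
  · simp only [Matrix.blockDiagonal'_apply_eq]
  · intro l _ hl
    exact Finset.sum_eq_zero fun j _ => by
      rw [Matrix.blockDiagonal'_apply_ne _ _ _ hl.symm, zero_smul]
  · simp

/-- The projection of `ℂ^{n₁ + ⋯ + n_N} ⊗ X` onto its `k`-th summand `ℂ^{n_k} ⊗ X`. -/
def tensorProj (n : Fin N → ℕ) (X : Type*) [NormedAddCommGroup X] [InnerProductSpace ℂ X]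
    (k : Fin N) : Tensor (TotalIndex n) X →L[ℂ] Tensor (Fin (n k)) X :=
  (PiLp.continuousLinearEquiv 2 ℂ (fun _ : Fin (n k) => X)).symm.toContinuousLinearMap ∘L
    ContinuousLinearMap.pi fun i =>
      PiLp.proj 2 (𝕜 := ℂ) (fun _ : TotalIndex n => X) ⟨k, i⟩

theorem diagHom_eq_sum_tensorProj (Z : Tuple n) :
    diagHom n X Z = ∑ k, adjoint (tensorProj n X k) ∘L ampl (Z k) ∘L tensorProj n X k := by
  refine ContinuousLinearMap.ext fun x => ext_inner_left ℂ fun y => ?_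
  simp only [sum_apply, inner_sum, ContinuousLinearMap.comp_apply,
    ContinuousLinearMap.adjoint_inner_right]
  simp only [PiLp.inner_apply, Fintype.sum_sigma, diagHom_apply, ampl_apply]
  rfl

/-- The operator with components `A k : U → ℂ^{n_k} ⊗ M_k`, into `ℂ^{n₁ + ⋯ + n_N} ⊗ X` where
`X` is the direct sum of all the `M_k`. -/
def tensorColumn (A : ∀ k, U →L[ℂ] Tensor (Fin (n k)) (M k)) :
    U →L[ℂ] Tensor (TotalIndex n) (PiLp 2 M) :=
  (PiLp.continuousLinearEquiv 2 ℂ (fun _ : TotalIndex n => PiLp 2 M)).symm.toContinuousLinearMap ∘L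
    ContinuousLinearMap.pi fun p =>
      (PiLp.continuousLinearEquiv 2 ℂ M).symm.toContinuousLinearMap ∘L
        ContinuousLinearMap.single ℂ M p.1 ∘L
          PiLp.proj 2 (𝕜 := ℂ) (fun _ : Fin (n p.1) => M p.1) p.2 ∘L A p.1

theorem tensorColumn_apply (A : ∀ k, U →L[ℂ] Tensor (Fin (n k)) (M k)) (x : U) (k : Fin N)
    (i : Fin (n k)) : tensorColumn A x ⟨k, i⟩ = PiLp.single 2 k (A k x i) := rfl

theorem inner_single_single {α : Type*} [Fintype α] [DecidableEq α] {K : α → Type*}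
    [∀ k, NormedAddCommGroup (K k)] [∀ k, InnerProductSpace ℂ (K k)] (k : α) (a b : K k) :
    inner ℂ (PiLp.single 2 k a) (PiLp.single 2 k b) = inner ℂ a b := by
  rw [PiLp.inner_apply, Finset.sum_eq_single k (fun l _ hl => by simp [hl]) (by simp)]
  simp

theorem adjoint_tensorColumn_comp_diagHom [CompleteSpace U] [∀ k, CompleteSpace (M k)]
    (A : ∀ k, U →L[ℂ] Tensor (Fin (n k)) (M k)) (B : ∀ k, V →L[ℂ] Tensor (Fin (n k)) (M k))
    (Z : Tuple n) :
    adjoint (tensorColumn A) ∘L diagHom n (PiLp 2 M) Z ∘L tensorColumn B =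
      ∑ k, adjoint (A k) ∘L ampl (Z k) ∘L B k := by
  refine ContinuousLinearMap.ext fun x => ext_inner_left ℂ fun y => ?_
  simp only [sum_apply, inner_sum, ContinuousLinearMap.comp_apply,
    ContinuousLinearMap.adjoint_inner_right]
  simp only [PiLp.inner_apply (𝕜 := ℂ) (f := fun _ : TotalIndex n => PiLp 2 M),
    PiLp.inner_apply (𝕜 := ℂ) (f := fun _ : Fin (n _) => M _), Fintype.sum_sigma,
    diagHom_apply, ampl_apply, inner_sum, inner_smul_right, tensorColumn_apply,
    inner_single_single]

theorem AUI.pi_single {α : Type*} [Fintype α] [DecidableEq α] {K : α → Type*}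
    [∀ k, NormedAddCommGroup (K k)] [∀ k, InnerProductSpace ℂ (K k)] (ι : ∀ k, AUI (K k))
    (k : α) (a : K k) : AUI.pi ι (PiLp.single 2 k a) = PiLp.single 2 k (ι k a) := by
  ext l
  change ι l (PiLp.single 2 k a l) = _
  rcases eq_or_ne l k with rfl | hl
  · simp
  · simpa [hl] using (ι l).map_zero

theorem isRealFun_tensorColumn {ι : AUI U} {ιM : ∀ k, AUI (M k)} {S : Set (Tuple n)}
    {φ : ∀ k, Tuple n → U →L[ℂ] Tensor (Fin (n k)) (M k)}
    (h : ∀ k, IsRealFun ι (AUI.tensor (Fin (n k)) (ιM k)) S (φ k)) :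
    IsRealFun ι (AUI.tensor (TotalIndex n) (AUI.pi ιM)) S
      fun Z => tensorColumn fun k => φ k Z := fun Z hZ x => by
  ext p : 1
  change AUI.pi ιM (PiLp.single 2 p.1 (φ p.1 (conjTuple Z) (ι x) p.2)) =
    PiLp.single 2 p.1 (φ p.1 Z x p.2)
  rw [AUI.pi_single, ← h p.1 Z hZ x]
  rfl

end DirectSum

section Pencil

variable {N : ℕ} {n : Fin N → ℕ}
  {U : Type*} [NormedAddCommGroup U] [InnerProductSpace ℂ U] [CompleteSpace U]
  {H : Type*} [NormedAddCommGroup H] [InnerProductSpace ℂ H] [CompleteSpace H]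
  {M : Fin N → Type*} [∀ k, NormedAddCommGroup (M k)] [∀ k, InnerProductSpace ℂ (M k)]
  [∀ k, CompleteSpace (M k)]
  {X : Type*} [NormedAddCommGroup X] [InnerProductSpace ℂ X] [CompleteSpace X]

theorem pencil_tensorProj_comp (G : WithLp 2 (U × H) →L[ℂ] Tensor (TotalIndex n) X)
    (Z : Tuple n) :
    pencil (fun k => tensorProj n X k ∘L G) Z = adjoint G ∘L diagHom n X Z ∘L G := by
  rw [diagHom_eq_sum_tensorProj]
  ext x
  simp [pencil, ContinuousLinearMap.adjoint_comp]

variable (G : ∀ k, WithLp 2 (U × H) →L[ℂ] Tensor (Fin (n k)) (M k))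

theorem differentiable_pencil : Differentiable ℂ (pencil G) := by
  have hampl (k) : Differentiable ℂ fun Z : Tuple n =>
      (ampl (Z k) : Tensor (Fin (n k)) (M k) →L[ℂ] _) :=
    Differentiable.comp (g := ampl) (differentiable_ampl (M k)) (differentiable_apply k)
  unfold pencil
  fun_prop

variable {G} in
theorem pencil_conjTuple_apply {κ : AUI (WithLp 2 (U × H))} {ιM : ∀ k, AUI (M k)}
    (hG : ∀ k, IsRealOp κ (AUI.tensor (Fin (n k)) (ιM k)) (G k)) (Z : Tuple n)
    (v : WithLp 2 (U × H)) : pencil G (conjTuple Z) (κ v) = κ (pencil G Z v) := by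
  simp only [pencil, sum_apply, ContinuousLinearMap.comp_apply, κ.map_sum]
  refine Finset.sum_congr rfl fun k _ => ?_
  rw [(hG k).adjoint, AUI.tensor_ampl, hG]
  rfl

end Pencil

section Doubling

variable {s : Type*} [Fintype s] {U V : Type*} [NormedAddCommGroup U] [InnerProductSpace ℂ U]
  [NormedAddCommGroup V] [InnerProductSpace ℂ V]
  {X : Type*} [NormedAddCommGroup X] [InnerProductSpace ℂ X]

/-- The operator `x ↦ (A x, B x)`, under the identification of the direct sum of two copies of
`ℂ^s ⊗ X` with `ℂ^s ⊗ (X ⊕ X)`. -/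
def tensorPair (A B : U →L[ℂ] Tensor s X) : U →L[ℂ] Tensor s (WithLp 2 (X × X)) :=
  (PiLp.continuousLinearEquiv 2 ℂ
      (fun _ : s => WithLp 2 (X × X))).symm.toContinuousLinearMap ∘L
    ContinuousLinearMap.pi fun i =>
      (WithLp.prodContinuousLinearEquiv 2 ℂ X X).symm.toContinuousLinearMap ∘L
        (PiLp.proj 2 (𝕜 := ℂ) (fun _ : s => X) i ∘L A).prod
          (PiLp.proj 2 (𝕜 := ℂ) (fun _ : s => X) i ∘L B)

theorem inner_tensorPair_ampl (A B : U →L[ℂ] Tensor s X) (C D : V →L[ℂ] Tensor s X)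
    (Z : Matrix s s ℂ) (x : U) (y : V) :
    inner ℂ (tensorPair A B x) (ampl Z (tensorPair C D y)) =
      inner ℂ (A x) (ampl Z (C y)) + inner ℂ (B x) (ampl Z (D y)) := by
  simp only [PiLp.inner_apply, ampl_apply, inner_sum, inner_smul_right, ← Finset.sum_add_distrib,
    ← mul_add]
  rfl

theorem AUI.tensor_swap_tensorPair (ι : AUI X) (A B : U →L[ℂ] Tensor s X)
    (C D : V →L[ℂ] Tensor s X) {x : U} {y : V} (hC : C y = AUI.tensor s ι (B x))
    (hD : D y = AUI.tensor s ι (A x)) :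
    AUI.tensor s ι.swap (tensorPair A B x) = tensorPair C D y := by
  ext i : 1
  change WithLp.toLp 2 (ι (B x i), ι (A x i)) = WithLp.toLp 2 (C y i, D y i)
  rw [hC, hD]
  rfl

end Doubling

section Factorization

variable {N : ℕ} {n : Fin N → ℕ}
  {U : Type*} [NormedAddCommGroup U] [InnerProductSpace ℂ U] [CompleteSpace U]
  {X : Type*} [NormedAddCommGroup X] [InnerProductSpace ℂ X] [CompleteSpace X]
  {M : Fin N → Type*} [∀ k, NormedAddCommGroup (M k)] [∀ k, InnerProductSpace ℂ (M k)]
  [∀ k, CompleteSpace (M k)]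
  {f : Tuple n → U →L[ℂ] U} {Φ : Tuple n → U →L[ℂ] Tensor (TotalIndex n) X}

/-- The decomposition `f(Z) = Φ(Y)^* (diag(Z₁, …, Z_N) ⊗ I) Φ(Z)` on the product of halfplanes.
It is the form of `IsDecomposition` in which all the spaces `M_k` are the same space `X`; the
function `Φ` is not assumed holomorphic. -/
def IsFactorization (f : Tuple n → U →L[ℂ] U)
    (Φ : Tuple n → U →L[ℂ] Tensor (TotalIndex n) X) : Prop :=
  ∀ Z ∈ halfplane n, ∀ Y ∈ halfplane n, f Z = adjoint (Φ Y) ∘L diagHom n X Z ∘L Φ Z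

/-- The function `f` has a factorization by an `(ι, ι_s ⊗ ι_X)`-real function, for some space `X`
and some anti-unitary involution `ι_X` on it. -/
def HasRealFactorization {U : Type u} [NormedAddCommGroup U] [InnerProductSpace ℂ U]
    [CompleteSpace U] (ι : AUI U) (f : Tuple n → U →L[ℂ] U) : Prop :=
  ∃ (X : Type u) (_ : NormedAddCommGroup X) (_ : InnerProductSpace ℂ X) (_ : CompleteSpace X)
    (Φ : Tuple n → U →L[ℂ] Tensor (TotalIndex n) X) (ιX : AUI X),
    IsFactorization f Φ ∧ IsRealFun ι (AUI.tensor (TotalIndex n) ιX) (halfplane n) Φ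

theorem isFactorization_iff_inner :
    IsFactorization f Φ ↔ ∀ Z ∈ halfplane n, ∀ Y ∈ halfplane n, ∀ x y,
      inner ℂ (Φ Y x) (diagHom n X Z (Φ Z y)) = inner ℂ x (f Z y) := by
  refine forall₄_congr fun Z _ Y _ => ⟨?_, fun h => ?_⟩
  · rintro h x y
    simp only [h, ContinuousLinearMap.comp_apply, ContinuousLinearMap.adjoint_inner_right]
  · refine ContinuousLinearMap.ext fun y => ext_inner_left ℂ fun x => ?_
    simp only [ContinuousLinearMap.comp_apply, ContinuousLinearMap.adjoint_inner_right, h]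

theorem IsDecomposition.isFactorization {φ : ∀ k, Tuple n → U →L[ℂ] Tensor (Fin (n k)) (M k)}
    (h : IsDecomposition f φ) : IsFactorization f fun Z => tensorColumn fun k => φ k Z :=
  fun Z hZ Y hY => (h.2 Z hZ Y hY).trans (adjoint_tensorColumn_comp_diagHom _ _ _).symm

theorem IsFactorization.conj {ι : AUI U} (h : IsFactorization f Φ)
    (hf : IsRealFun ι ι (halfplane n) f) (κ : AUI X) :
    IsFactorization f fun Z => ι.conj (AUI.tensor (TotalIndex n) κ) (Φ (conjTuple Z)) := by
  rw [isFactorization_iff_inner] at h ⊢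
  intro Z hZ Y hY x y
  have hP := AUI.tensor_diagHom κ (conjTuple Z) (Φ (conjTuple Z) (ι y))
  rw [conjTuple_conjTuple] at hP
  rw [AUI.conj_apply, AUI.conj_apply, ← hP, AUI.inner_map, ← inner_conj_symm,
    h _ (conjTuple_mem_halfplane hZ) _ (conjTuple_mem_halfplane hY), inner_conj_symm, ← hf Z hZ y,
    ← ι.inner_map (ι _) x, ι.invol]

/-- Since `f` is real, `Φ` and its conjugate factorize the same function; the swap of the two
summands makes their direct sum real, and `1 / √2` normalizes the sum `f + f`. -/
theorem IsFactorization.hasRealFactorization {U X : Type u} [NormedAddCommGroup U]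
    [InnerProductSpace ℂ U] [CompleteSpace U] [NormedAddCommGroup X] [InnerProductSpace ℂ X]
    [CompleteSpace X] {ι : AUI U} {f : Tuple n → U →L[ℂ] U}
    {Φ : Tuple n → U →L[ℂ] Tensor (TotalIndex n) X} (h : IsFactorization f Φ)
    (hf : IsRealFun ι ι (halfplane n) f) : HasRealFactorization ι f := by
  obtain ⟨κ⟩ := AUI.nonempty X
  have hconj := h.conj hf κ
  set Ψ := fun Z => ι.conj (AUI.tensor (TotalIndex n) κ) (Φ (conjTuple Z))
  let r : ℂ := ((√2)⁻¹ : ℝ)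
  have hr : starRingEnd ℂ r = r := Complex.conj_ofReal _
  have hrr : r * r = 1 / 2 := by
    rw [← Complex.ofReal_mul, ← mul_inv, Real.mul_self_sqrt zero_le_two]
    norm_num
  refine ⟨WithLp 2 (X × X), inferInstance, inferInstance, inferInstance,
    fun Z => r • tensorPair (Φ Z) (Ψ Z), κ.swap, ?_, fun Z _ x => ?_⟩
  · rw [isFactorization_iff_inner] at h hconj ⊢
    intro Z hZ Y hY x y
    rw [smul_apply, smul_apply, map_smul, inner_smul_left, inner_smul_right, hr, ← mul_assoc, hrr]
    refine (congrArg _ (inner_tensorPair_ampl _ _ _ _ _ x y)).trans ?_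
    refine (congrArg _ (congrArg₂ _ (h Z hZ Y hY x y) (hconj Z hZ Y hY x y))).trans ?_
    ring
  · rw [smul_apply, smul_apply, AUI.map_smul, hr]
    congr 1
    apply AUI.tensor_swap_tensorPair
    · simp only [Ψ, AUI.conj_apply, conjTuple_conjTuple, ι.invol, AUI.invol]
    · simp only [Ψ, AUI.conj_apply]

end Factorization

section LongResolvent

variable {N : ℕ} {n : Fin N → ℕ}
  {U : Type*} [NormedAddCommGroup U] [InnerProductSpace ℂ U] [CompleteSpace U]
  {H : Type*} [NormedAddCommGroup H] [InnerProductSpace ℂ H] [CompleteSpace H]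
  {M : Fin N → Type*} [∀ k, NormedAddCommGroup (M k)] [∀ k, InnerProductSpace ℂ (M k)]
  [∀ k, CompleteSpace (M k)]
  {f : Tuple n → U →L[ℂ] U} {G : ∀ k, WithLp 2 (U × H) →L[ℂ] Tensor (Fin (n k)) (M k)}
  {ι : AUI U} {ιH : AUI H} {ιM : ∀ k, AUI (M k)}

theorem IsLongResolvent.isDecomposition (h : IsLongResolvent f G) :
    IsDecomposition f fun k Z => G k ∘L schurColumn (pencil G Z) := by
  refine ⟨fun k => ?_, fun Z hZ Y _ => ?_⟩
  · have hcol : DifferentiableOn ℂ (fun Z => schurColumn (pencil G Z)) (halfplane n) :=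
      fun Z hZ => (differentiableAt_schurColumn (differentiable_pencil G Z)
        (h Z (halfplane_subset_Omega hZ)).1).differentiableWithinAt
    fun_prop
  · obtain ⟨hd, hfZ⟩ := h Z (halfplane_subset_Omega hZ)
    change f Z = schurComplement (pencil G Z) at hfZ
    refine ContinuousLinearMap.ext fun x => ext_inner_left ℂ fun y => ?_
    have hpencil : inner ℂ (schurColumn (pencil G Y) y) (pencil G Z (schurColumn (pencil G Z) x)) =
        inner ℂ y (f Z x) := by
      rw [apply_schurColumn hd, schurColumn_apply, ← hfZ]
      simp [WithLp.prod_inner_apply]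
    rw [← hpencil]
    simp [pencil, inner_sum, ContinuousLinearMap.adjoint_inner_right]

theorem IsLongResolvent.isRealFun (h : IsLongResolvent f G)
    (hG : ∀ k, IsRealOp (ι.prod ιH) (AUI.tensor (Fin (n k)) (ιM k)) (G k)) :
    IsRealFun ι ι (Omega n) f := isRealFun_iff.2 fun Z hZ x => by
  obtain ⟨hd, hfZ⟩ := h Z hZ
  obtain ⟨hd', hfZ'⟩ := h _ (conjTuple_mem_Omega hZ)
  rw [hfZ, hfZ']
  exact schurComplement_prod hd hd' (pencil_conjTuple_apply hG Z) x

theorem IsLongResolvent.isRealFun_comp_schurColumn (h : IsLongResolvent f G)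
    (hG : ∀ k, IsRealOp (ι.prod ιH) (AUI.tensor (Fin (n k)) (ιM k)) (G k)) (k : Fin N) :
    IsRealFun ι (AUI.tensor (Fin (n k)) (ιM k)) (Omega n)
      fun Z => G k ∘L schurColumn (pencil G Z) := isRealFun_iff.2 fun Z hZ x => by
  rw [ContinuousLinearMap.comp_apply, schurColumn_prod (h Z hZ).1 (h _ (conjTuple_mem_Omega hZ)).1
    (pencil_conjTuple_apply hG Z) x, ← hG k]
  rfl

end LongResolvent

section Homogeneity

variable {N : ℕ} {n : Fin N → ℕ}
  {V : Type*} [NormedAddCommGroup V] [NormedSpace ℂ V]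

/-- The entire functions `w ↦ f(e^w Z)` and `w ↦ e^w f(Z)` agree on the real line. -/
theorem map_smul_of_map_ofReal_smul [CompleteSpace V] {f : Tuple n → V}
    (hf : DifferentiableOn ℂ f (Omega n)) {Z : Tuple n} (hZ : Z ∈ halfplane n)
    (hreal : ∀ r : ℝ, 0 < r → f ((r : ℂ) • Z) = (r : ℂ) • f Z) {c : ℂ} (hc : c ≠ 0) :
    f (c • Z) = c • f Z := by
  have hleft : Differentiable ℂ fun w : ℂ => f (Complex.exp w • Z) :=
    differentiableOn_univ.1 <| hf.comp
      (Complex.differentiable_exp.smul_const Z).differentiableOn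
      fun w _ => smul_mem_Omega (Complex.exp_ne_zero w) hZ
  have hright : Differentiable ℂ fun w : ℂ => Complex.exp w • f Z :=
    Complex.differentiable_exp.smul_const (f Z)
  have hofReal : Filter.Tendsto (fun r : ℝ => (r : ℂ)) (nhdsWithin 0 {0}ᶜ) (nhdsWithin 0 {0}ᶜ) :=
    Complex.continuous_ofReal.continuousAt.continuousWithinAt.tendsto_nhdsWithin fun r hr => by
      simpa using hr
  have hfreq : ∃ᶠ w in nhdsWithin (0 : ℂ) {0}ᶜ,
      f (Complex.exp w • Z) = Complex.exp w • f Z := by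
    refine hofReal.frequently (Filter.Frequently.of_forall fun r => ?_)
    rw [← Complex.ofReal_exp]
    exact hreal _ (Real.exp_pos r)
  have heq := AnalyticOnNhd.eq_of_frequently_eq (fun w _ => hleft.analyticAt w)
    (fun w _ => hright.analyticAt w) hfreq
  simpa [Complex.exp_log hc] using congrFun heq (Complex.log c)

end Homogeneity

section Compression

variable {E F : Type*} [NormedAddCommGroup E] [InnerProductSpace ℂ E] [CompleteSpace E]
  [NormedAddCommGroup F] [InnerProductSpace ℂ F] [CompleteSpace F]
  {K : Type*} [NormedAddCommGroup K] [InnerProductSpace ℂ K] [CompleteSpace K]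

theorem isUnit_adjoint_comp_comp {S : E →L[ℂ] F} (hS : adjoint S ∘L S = 1) {A : F →L[ℂ] F}
    (hA : IsStrictlyPositive (A + star A)) : IsUnit (adjoint S ∘L A ∘L S) := by
  obtain ⟨ε, hε, hle⟩ := exists_algebraMap_le_of_isStrictlyPositive hA
  refine isUnit_of_isStrictlyPositive_add_star
    (.of_le (isStrictlyPositive_algebraMap (A := E →L[ℂ] E) hε) ?_)
  rw [ContinuousLinearMap.le_def] at hle ⊢
  convert hle.adjoint_conj S using 1
  have hone : adjoint S ∘L algebraMap ℝ (F →L[ℂ] F) ε ∘L S = algebraMap ℝ (E →L[ℂ] E) ε := by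
    ext x
    simpa [Algebra.algebraMap_eq_smul_one] using congrArg (ε • ·) (congrArg (· x) hS)
  rw [← hone]
  ext x
  simp [ContinuousLinearMap.star_eq_adjoint, ContinuousLinearMap.adjoint_comp]

theorem block22_adjoint_comp_comp (G : WithLp 2 (E × F) →L[ℂ] K) (A : K →L[ℂ] K) :
    block22 (adjoint G ∘L A ∘L G) = adjoint (G ∘L inrL E F) ∘L A ∘L (G ∘L inrL E F) := by
  refine ContinuousLinearMap.ext fun x => ext_inner_left ℂ fun y => ?_
  rw [ContinuousLinearMap.comp_apply, ContinuousLinearMap.adjoint_inner_right]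
  simp [block22, inrL, WithLp.prod_inner_apply, ← ContinuousLinearMap.adjoint_inner_right]

end Compression

section StateSpace

variable {N : ℕ} {n : Fin N → ℕ}
  {U : Type*} [NormedAddCommGroup U] [InnerProductSpace ℂ U]
  {X : Type*} [NormedAddCommGroup X] [InnerProductSpace ℂ X] [CompleteSpace X]
  {f : Tuple n → U →L[ℂ] U} {Φ : Tuple n → U →L[ℂ] Tensor (TotalIndex n) X}

/-- The state space of a long resolvent representation built from a factorization
`f(Z) = Φ(Y)^* P(Z) Φ(Z)`: the vectors orthogonal to the range of `P(Z) Φ(Z)` for all `Z`. All the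
differences `Φ(Y) x - Φ(Y') x` lie in it. -/
def stateSpace (Φ : Tuple n → U →L[ℂ] Tensor (TotalIndex n) X) :
    Submodule ℂ (Tensor (TotalIndex n) X) :=
  (Submodule.span ℂ {v | ∃ Z ∈ halfplane n, ∃ x, diagHom n X Z (Φ Z x) = v})ᗮ

instance : CompleteSpace (stateSpace Φ) :=
  (Submodule.isClosed_orthogonal _).completeSpace_coe

theorem inner_apply_eq_zero_of_mem_stateSpace {h : Tensor (TotalIndex n) X}
    (hh : h ∈ stateSpace Φ) {Z : Tuple n} (hZ : Z ∈ halfplane n) (x : U) :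
    inner ℂ h (diagHom n X Z (Φ Z x)) = 0 :=
  (Submodule.mem_orthogonal' _ _).1 hh _ (Submodule.subset_span ⟨Z, hZ, x, rfl⟩)

theorem tensor_mem_stateSpace {ι : AUI U} {ιX : AUI X}
    (hΦ : IsRealFun ι (AUI.tensor (TotalIndex n) ιX) (halfplane n) Φ) :
    ∀ h ∈ stateSpace Φ, AUI.tensor (TotalIndex n) ιX h ∈ stateSpace Φ := by
  refine fun h hh => AUI.mem_orthogonal _ (fun v hv => AUI.mem_span _ ?_ hv) hh
  rintro _ ⟨Z, hZ, x, rfl⟩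
  exact ⟨conjTuple Z, conjTuple_mem_halfplane hZ, ι x, by
    rw [isRealFun_iff.1 hΦ Z hZ, AUI.tensor_diagHom]⟩

/-- The operator `G(x, h) = Φ(1) x + h` on `U ⊕ stateSpace Φ`; its pencil `G^* P(Z) G` represents
`f`. -/
def stateOperator (Φ : Tuple n → U →L[ℂ] Tensor (TotalIndex n) X) :
    WithLp 2 (U × stateSpace Φ) →L[ℂ] Tensor (TotalIndex n) X :=
  Φ 1 ∘L WithLp.fstL 2 ℂ U (stateSpace Φ) +
    (stateSpace Φ).subtypeL ∘L WithLp.sndL 2 ℂ U (stateSpace Φ)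

theorem isRealOp_stateOperator {ι : AUI U} {ιX : AUI X}
    (hΦ : IsRealFun ι (AUI.tensor (TotalIndex n) ιX) (halfplane n) Φ) :
    IsRealOp (ι.prod ((AUI.tensor (TotalIndex n) ιX).restrict _ (tensor_mem_stateSpace hΦ)))
      (AUI.tensor (TotalIndex n) ιX) (stateOperator Φ) := fun v => by
  have h1 := isRealFun_iff.1 hΦ 1 one_mem_halfplane v.fst
  rw [conjTuple_one] at h1
  change AUI.tensor (TotalIndex n) ιX (Φ 1 v.fst + v.snd) = Φ 1 (ι v.fst) + _
  rw [AUI.map_add, ← h1]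
  rfl

variable [CompleteSpace U]

theorem IsFactorization.sub_mem_stateSpace (h : IsFactorization f Φ) {Y Y' : Tuple n}
    (hY : Y ∈ halfplane n) (hY' : Y' ∈ halfplane n) (x : U) : Φ Y x - Φ Y' x ∈ stateSpace Φ := by
  rw [isFactorization_iff_inner] at h
  refine (Submodule.mem_orthogonal' _ _).2 fun v hv => ?_
  induction hv using Submodule.span_induction with
  | mem v hv =>
    obtain ⟨Z, hZ, y, rfl⟩ := hv
    rw [inner_sub_left, h Z hZ Y hY, h Z hZ Y' hY', sub_self]
  | zero => exact inner_zero_right _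
  | add v w _ _ hv hw => rw [inner_add_right, hv, hw, add_zero]
  | smul c v _ hv => rw [inner_smul_right, hv, mul_zero]

theorem isUnit_block22_stateOperator {Z : Tuple n} (hZ : Z ∈ halfplane n) :
    IsUnit (block22 (adjoint (stateOperator Φ) ∘L diagHom n X Z ∘L stateOperator Φ)) := by
  have hinr : stateOperator Φ ∘L inrL U (stateSpace Φ) = (stateSpace Φ).subtypeL := by
    ext h
    simp [stateOperator, inrL]
  have hone : adjoint (stateSpace Φ).subtypeL ∘L (stateSpace Φ).subtypeL = 1 := by
    rw [Submodule.adjoint_subtypeL]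
    exact ContinuousLinearMap.ext (Submodule.orthogonalProjectionOnto_mem_subspace_eq_self ·)
  rw [block22_adjoint_comp_comp, hinr]
  exact isUnit_adjoint_comp_comp hone (isStrictlyPositive_diagHom_add_star hZ)

theorem IsFactorization.stateOperator_apply (h : IsFactorization f Φ) {Z : Tuple n}
    (hZ : Z ∈ halfplane n) (x : U) :
    (adjoint (stateOperator Φ) ∘L diagHom n X Z ∘L stateOperator Φ)
      (WithLp.toLp 2 (x, ⟨_, h.sub_mem_stateSpace hZ one_mem_halfplane x⟩)) =
      WithLp.toLp 2 (f Z x, 0) := by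
  refine ext_inner_left ℂ fun v => ?_
  have hG : stateOperator Φ (WithLp.toLp 2
      (x, ⟨_, h.sub_mem_stateSpace hZ one_mem_halfplane x⟩)) = Φ Z x :=
    add_sub_cancel (Φ 1 x) (Φ Z x)
  have hv : stateOperator Φ v = Φ 1 v.fst + v.snd := rfl
  rw [ContinuousLinearMap.comp_apply, ContinuousLinearMap.comp_apply, hG,
    ContinuousLinearMap.adjoint_inner_right, hv, inner_add_left,
    isFactorization_iff_inner.1 h Z hZ 1 one_mem_halfplane,
    inner_apply_eq_zero_of_mem_stateSpace v.snd.2 hZ]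
  simp [WithLp.prod_inner_apply]

theorem IsFactorization.isLongResolvent (h : IsFactorization f Φ)
    (hf : DifferentiableOn ℂ f (Omega n)) :
    IsLongResolvent (M := fun _ => X) f fun k => tensorProj n X k ∘L stateOperator Φ := by
  let T (Z : Tuple n) := adjoint (stateOperator Φ) ∘L diagHom n X Z ∘L stateOperator Φ
  have hunit (Z : Tuple n) (hZ : Z ∈ halfplane n) : IsUnit (block22 (T Z)) :=
    isUnit_block22_stateOperator hZ
  have hT (c : ℂ) (Z : Tuple n) : T (c • Z) = c • T Z := by
    simp [T]
  have hfT (Z : Tuple n) (hZ : Z ∈ halfplane n) : f Z = schurComplement (T Z) :=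
    ContinuousLinearMap.ext fun x => (schurComplement_apply_eq (hunit Z hZ)
      (h.stateOperator_apply hZ x)).symm
  have hhom (c : ℂ) (hc : c ≠ 0) (Z : Tuple n) (hZ : Z ∈ halfplane n) : f (c • Z) = c • f Z := by
    refine map_smul_of_map_ofReal_smul hf hZ (fun r hr => ?_) hc
    rw [hfT _ (by simpa using smul_mem_halfplane hr hZ), hT, hfT Z hZ,
      schurComplement_smul (hunit Z hZ) (by simpa using hr.ne')]
  rintro _ ⟨c, hc, Z, hZ, rfl⟩
  have hc0 : c ≠ 0 := norm_ne_zero_iff.1 (hc ▸ one_ne_zero)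
  have hpencil : pencil (M := fun _ => X) (fun k => tensorProj n X k ∘L stateOperator Φ) (c • Z) =
      c • T Z := (pencil_tensorProj_comp _ _).trans (hT c Z)
  rw [hpencil, hhom c hc0 Z hZ, hfT Z hZ,
    ← schurComplement_smul (hunit Z hZ) hc0]
  exact ⟨isUnit_block22_smul (hunit Z hZ) hc0, rfl⟩

end StateSpace

section Involution

variable {E F : Type*} [NormedAddCommGroup E] [InnerProductSpace ℂ E]
  [NormedAddCommGroup F] [InnerProductSpace ℂ F]

theorem apply_eq_iff_of_mul_self_eq_one {T : E →L[ℂ] E} (hTT : T * T = 1) (a b : E) :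
    T a = b ↔ T (a + b) = a + b ∧ T (a - b) = -(a - b) := by
  constructor
  · rintro rfl
    have hTTa : T (T a) = a := congrArg (· a) hTT
    rw [map_add, map_sub, hTTa]
    exact ⟨add_comm _ _, (neg_sub _ _).symm⟩
  · rintro ⟨hfix, hneg⟩
    have h2 : (2 : ℂ) • T a = (2 : ℂ) • b := by
      rw [← map_smul, two_smul, two_smul, ← add_add_sub_cancel a a b, map_add, hfix, hneg]
      abel
    exact smul_right_injective _ two_ne_zero h2

theorem inner_eq_zero_of_apply_eq [CompleteSpace E] {T : E →L[ℂ] E} (hT : adjoint T = T) {p q : E}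
    (hp : T p = p) (hq : T q = -q) : inner ℂ p q = 0 := by
  have h : inner ℂ p q = -inner ℂ p q := calc
    inner ℂ p q = inner ℂ (T p) q := by rw [hp]
    _ = inner ℂ p (T q) := by rw [← ContinuousLinearMap.adjoint_inner_right, hT]
    _ = -inner ℂ p q := by rw [hq, inner_neg_right]
  exact self_eq_neg.1 h

theorem eq_zero_of_inner_apply_self_eq_zero [CompleteSpace E] {A : E →L[ℂ] E}
    (hA : IsStrictlyPositive (A + star A)) {x : E} (hx : inner ℂ x (A x) = 0) : x = 0 := by
  obtain ⟨ε, hε, hle⟩ := exists_algebraMap_le_of_isStrictlyPositive hA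
  have hinner : 0 ≤ -(ε * ‖x‖ ^ 2) := by
    have hre := (ContinuousLinearMap.le_def _ _).1 hle |>.re_inner_nonneg_right x
    have hx' : inner ℂ x (star A x) = 0 := by
      rw [ContinuousLinearMap.star_eq_adjoint, ContinuousLinearMap.adjoint_inner_right,
        inner_eq_zero_symm, hx]
    simpa [inner_sub_right, inner_add_right, hx, hx', Algebra.algebraMap_eq_smul_one,
      inner_smul_right_eq_smul, inner_self_eq_norm_sq_to_K, ← Complex.ofReal_pow] using hre
  have hnorm : ‖x‖ ^ 2 ≤ 0 := by nlinarith
  exact norm_eq_zero.1 (pow_eq_zero_iff two_ne_zero |>.1 (le_antisymm hnorm (sq_nonneg _)))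

/-- The reflection in a closed subspace as a bounded operator. -/
def reflectionL (S : Submodule ℂ E) [S.HasOrthogonalProjection] : E →L[ℂ] E :=
  S.reflection.toLinearIsometry.toContinuousLinearMap

variable (S : Submodule ℂ E) [S.HasOrthogonalProjection]

theorem reflectionL_mul_self : reflectionL S * reflectionL S = 1 :=
  ContinuousLinearMap.ext S.reflection_reflection

theorem adjoint_reflectionL [CompleteSpace E] : adjoint (reflectionL S) = reflectionL S := by
  refine ((ContinuousLinearMap.eq_adjoint_iff _ _).2 fun x y => ?_).symm
  change inner ℂ (S.reflection x) y = inner ℂ x (S.reflection y)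
  rw [← S.reflection.inner_map_map, S.reflection_reflection]

variable {S}

theorem isRealOp_reflectionL {ι : AUI E} (hS : ∀ x ∈ S, ι x ∈ S) :
    IsRealOp ι ι (reflectionL S) := fun x => by
  obtain ⟨p, hp, q, hq, rfl⟩ := S.exists_add_mem_mem_orthogonal x
  have hreflect {p q : E} (hp : p ∈ S) (hq : q ∈ Sᗮ) : reflectionL S (p + q) = p + -q :=
    (map_add S.reflection p q).trans <| congrArg₂ _ (S.reflection_mem_subspace_eq_self hp)
      (S.reflection_mem_subspace_orthogonalComplement_eq_neg hq)
  rw [hreflect hp hq, ι.map_add, ι.map_neg, ι.map_add, hreflect (hS p hp) (ι.mem_orthogonal hS hq)]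

end Involution

section TransferFunction

variable {E F : Type*} [NormedAddCommGroup E] [InnerProductSpace ℂ E]
  [NormedAddCommGroup F] [InnerProductSpace ℂ F]
  {T : WithLp 2 (E × F) →L[ℂ] WithLp 2 (E × F)} {P W : E →L[ℂ] E}

/-- The state `t = (1 - A W)⁻¹ B x` of the system `T = [A B; C D]` with feedback `W`, as a function
of the input `x`; it is determined by `T (W t, x) = (t, y)`, where `y` is the output. -/
def transferState (T : WithLp 2 (E × F) →L[ℂ] WithLp 2 (E × F)) (W : E →L[ℂ] E) : F →L[ℂ] E :=
  Ring.inverse (1 - block11 T ∘L W) ∘L block12 T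

/-- The transfer function `D + C W (1 - A W)⁻¹ B` of `T = [A B; C D]`. -/
def transferFunction (T : WithLp 2 (E × F) →L[ℂ] WithLp 2 (E × F)) (W : E →L[ℂ] E) : F →L[ℂ] F :=
  block22 T + block21 T ∘L W ∘L transferState T W

theorem apply_transferState (hW : IsUnit (1 - block11 T ∘L W)) (x : F) :
    T (WithLp.toLp 2 (W (transferState T W x), x)) =
      WithLp.toLp 2 (transferState T W x, transferFunction T W x) := by
  have hstate : transferState T W x - block11 T (W (transferState T W x)) = block12 T x :=
    apply_inverse_apply hW (block12 T x)
  rw [apply_toLp, ← hstate, add_sub_cancel, add_comm]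
  rfl

theorem transferFunction_apply_eq (hW : IsUnit (1 - block11 T ∘L W)) {t : E} {x y : F}
    (h : T (WithLp.toLp 2 (W t, x)) = WithLp.toLp 2 (t, y)) : transferFunction T W x = y := by
  rw [apply_toLp] at h
  have hfst : block11 T (W t) + block12 T x = t := congrArg WithLp.fst h
  have hsnd : block21 T (W t) + block22 T x = y := congrArg WithLp.snd h
  have hstate : transferState T W x = t := by
    have hB : (1 - block11 T ∘L W) t = block12 T x := sub_eq_of_eq_add' hfst.symm
    rw [transferState, ContinuousLinearMap.comp_apply, ← hB, inverse_apply_apply hW]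
  rw [← hsnd, ← hstate, add_comm]
  rfl

theorem norm_block11_le (T : WithLp 2 (E × F) →L[ℂ] WithLp 2 (E × F)) : ‖block11 T‖ ≤ ‖T‖ := by
  refine ContinuousLinearMap.opNorm_le_bound _ T.opNorm_nonneg fun x => ?_
  calc ‖block11 T x‖ ≤ ‖T (WithLp.toLp 2 (x, 0))‖ := WithLp.norm_fst_le _ _
    _ ≤ ‖T‖ * ‖x‖ := by simpa using T.le_opNorm (WithLp.toLp 2 (x, 0))

theorem isUnit_one_sub_block11_comp [CompleteSpace E] (hT : ‖T‖ ≤ 1) (hW : ‖W‖ < 1) :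
    IsUnit (1 - block11 T ∘L W) := by
  refine isUnit_one_sub_of_norm_lt_one ((ContinuousLinearMap.opNorm_comp_le _ _).trans_lt ?_)
  nlinarith [norm_block11_le T, norm_nonneg W]

/-- In terms of the Cayley transforms `P = (1 + W)(1 - W)⁻¹` of `W` and `g` of the transfer
function, the relation between input, state and output describes the two eigenspaces of `T`. -/
theorem apply_eq_iff_of_cayley (hTT : T * T = 1) (hPW : P * (1 - W) = 1 + W) (t : E) (g v : F) :
    T (WithLp.toLp 2 (W t, (2 : ℂ)⁻¹ • (g + v))) = WithLp.toLp 2 (t, (2 : ℂ)⁻¹ • (g - v)) ↔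
      T (WithLp.toLp 2 (P ((1 - W) t), g)) = WithLp.toLp 2 (P ((1 - W) t), g) ∧
        T (WithLp.toLp 2 (-(1 - W) t, v)) = -WithLp.toLp 2 (-(1 - W) t, v) := by
  have hP : P ((1 - W) t) = W t + t := (congrArg (· t) hPW).trans (add_comm _ _)
  have hW : -(1 - W) t = W t - t := neg_sub _ _
  have hg : (2 : ℂ)⁻¹ • (g + v) + (2 : ℂ)⁻¹ • (g - v) = g := by module
  have hv : (2 : ℂ)⁻¹ • (g + v) - (2 : ℂ)⁻¹ • (g - v) = v := by module
  rw [apply_eq_iff_of_mul_self_eq_one hTT, ← WithLp.toLp_add, ← WithLp.toLp_sub, Prod.mk_add_mk,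
    Prod.mk_sub_mk, hg, hv, hP, hW]

/-- The difference `k - k'` is orthogonal to its image under the strictly accretive operator `P`,
because the eigenspaces of `T` are orthogonal. -/
theorem eq_of_apply_eq_self_of_apply_eq_neg [CompleteSpace E] [CompleteSpace F]
    (hT : adjoint T = T) (hP : IsStrictlyPositive (P + star P)) {k k' : E} {v v' x : F}
    (hfix : T (WithLp.toLp 2 (P k, v)) = WithLp.toLp 2 (P k, v))
    (hneg : T (WithLp.toLp 2 (-k, x)) = -WithLp.toLp 2 (-k, x))
    (hfix' : T (WithLp.toLp 2 (P k', v')) = WithLp.toLp 2 (P k', v'))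
    (hneg' : T (WithLp.toLp 2 (-k', x)) = -WithLp.toLp 2 (-k', x)) : k = k' := by
  have horth := inner_eq_zero_of_apply_eq hT
    (p := WithLp.toLp 2 (P k, v) - WithLp.toLp 2 (P k', v'))
    (q := WithLp.toLp 2 (-k, x) - WithLp.toLp 2 (-k', x))
    (by rw [map_sub, hfix, hfix']) (by rw [map_sub, hneg, hneg', neg_sub_neg, neg_sub])
  rw [← WithLp.toLp_sub, ← WithLp.toLp_sub, Prod.mk_sub_mk, Prod.mk_sub_mk, sub_self,
    neg_sub_neg, ← neg_sub k k', ← map_sub, WithLp.prod_inner_apply, inner_zero_right, add_zero,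
    inner_neg_right, neg_eq_zero, inner_eq_zero_symm] at horth
  exact sub_eq_zero.1 (eq_zero_of_inner_apply_self_eq_zero hP horth)

end TransferFunction

section Realization

variable {N : ℕ} {n : Fin N → ℕ}
  {U : Type*} [NormedAddCommGroup U] [InnerProductSpace ℂ U]
  {X : Type*} [NormedAddCommGroup X] [InnerProductSpace ℂ X] [CompleteSpace X]
  {f : Tuple n → U →L[ℂ] U} {Φ : Tuple n → U →L[ℂ] Tensor (TotalIndex n) X}
  {T : WithLp 2 (Tensor (TotalIndex n) X × U) →L[ℂ] WithLp 2 (Tensor (TotalIndex n) X × U)}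
  {ι : AUI U} {ιX : AUI X}

theorem doubleCayley_apply {W : Tuple n} (hf : IsUnit (f (cayley W) + 1)) (x : U) :
    doubleCayley f W ((2 : ℂ)⁻¹ • (f (cayley W) x + x)) = (2 : ℂ)⁻¹ • (f (cayley W) x - x) := by
  have hx : Ring.inverse (f (cayley W) + 1) (f (cayley W) x + x) = x := inverse_apply_apply hf x
  rw [map_smul, doubleCayley, mul_apply_eq_comp, hx]
  rfl

/-- For all `Z` in the product of halfplanes the vectors `(P(Z) Φ(Z) x, f(Z) x)` are fixed by `T`
and the vectors `(-Φ(Z) x, x)` are negated by `T`, where `P(Z) = diag(Z₁, …, Z_N) ⊗ I`. -/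
def IsEigenColumn (f : Tuple n → U →L[ℂ] U) (Φ : Tuple n → U →L[ℂ] Tensor (TotalIndex n) X)
    (T : WithLp 2 (Tensor (TotalIndex n) X × U) →L[ℂ] WithLp 2 (Tensor (TotalIndex n) X × U)) :
    Prop :=
  ∀ Z ∈ halfplane n, ∀ x,
    T (WithLp.toLp 2 (diagHom n X Z (Φ Z x), f Z x)) =
      WithLp.toLp 2 (diagHom n X Z (Φ Z x), f Z x) ∧
    T (WithLp.toLp 2 (-Φ Z x, x)) = -WithLp.toLp 2 (-Φ Z x, x)

theorem IsEigenColumn.isRealization (h : IsEigenColumn f Φ T) (hf : DoubleCayleyDefined f)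
    (hnorm : ‖T‖ ≤ 1) (hTT : T * T = 1) : IsRealization (doubleCayley f) T := fun W hW => by
  have hW1 := norm_diagHom_lt_one (X := X) hW
  have hunit := isUnit_one_sub_block11_comp hnorm hW1
  refine ⟨hunit, ContinuousLinearMap.ext fun u => (?_ : _ = transferFunction T (diagHom n X W) u)⟩
  obtain ⟨v, rfl⟩ : ∃ v, (2 : ℂ)⁻¹ • (f (cayley W) v + v) = u :=
    ⟨Ring.inverse (f (cayley W) + 1) ((2 : ℂ) • u), by
      rw [← inv_smul_smul₀ (two_ne_zero (α := ℂ)) u]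
      exact congrArg _ (by simpa using apply_inverse_apply (hf W hW) ((2 : ℂ) • u))⟩
  rw [doubleCayley_apply (hf W hW), eq_comm]
  refine transferFunction_apply_eq hunit (t := Ring.inverse (1 - diagHom n X W) (Φ (cayley W) v)) ?_
  rw [apply_eq_iff_of_cayley hTT (diagHom_cayley_mul_one_sub hW),
    apply_inverse_apply (isUnit_one_sub_of_norm_lt_one hW1)]
  simpa using h _ (cayley_mem_halfplane hW) v

theorem IsRealization.exists_isEigenColumn (h : IsRealization (doubleCayley f) T)
    (hf : DoubleCayleyDefined f) (hTT : T * T = 1) : ∃ Φ, IsEigenColumn f Φ T := by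
  have hexists (Z : Tuple n) (hZ : Z ∈ halfplane n) :
      ∃ φ : U →L[ℂ] Tensor (TotalIndex n) X, ∀ x,
        T (WithLp.toLp 2 (diagHom n X Z (φ x), f Z x)) =
          WithLp.toLp 2 (diagHom n X Z (φ x), f Z x) ∧
        T (WithLp.toLp 2 (-φ x, x)) = -WithLp.toLp 2 (-φ x, x) := by
    obtain ⟨W, hW, rfl⟩ := exists_mem_disk_cayley_eq hZ
    obtain ⟨hunit, htransfer⟩ := h W hW
    change IsUnit (1 - block11 T ∘L diagHom n X W) at hunit
    change doubleCayley f W = transferFunction T (diagHom n X W) at htransfer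
    refine ⟨(1 - diagHom n X W) ∘L transferState T (diagHom n X W) ∘L
      ((2 : ℂ)⁻¹ • (f (cayley W) + 1)), fun x => ?_⟩
    have hstate := apply_transferState hunit ((2 : ℂ)⁻¹ • (f (cayley W) x + x))
    rw [← htransfer, doubleCayley_apply (hf W hW)] at hstate
    exact (apply_eq_iff_of_cayley hTT (diagHom_cayley_mul_one_sub hW) _ _ _).1 hstate
  choose! Φ hΦ using hexists
  exact ⟨Φ, hΦ⟩

variable [CompleteSpace U]

theorem IsFactorization.doubleCayleyDefined (h : IsFactorization f Φ) :
    DoubleCayleyDefined f := fun W hW => by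
  have hZ := cayley_mem_halfplane hW
  refine isUnit_add_one_of_add_star_nonneg ?_
  have hP := (isStrictlyPositive_diagHom_add_star (X := X) hZ).nonneg
  rw [ContinuousLinearMap.nonneg_iff_isPositive] at hP ⊢
  convert hP.adjoint_conj (Φ (cayley W)) using 1
  rw [h _ hZ _ hZ]
  ext x
  simp [ContinuousLinearMap.star_eq_adjoint, ContinuousLinearMap.adjoint_comp]

theorem IsEigenColumn.isFactorization (h : IsEigenColumn f Φ T) (hT : adjoint T = T) :
    IsFactorization f Φ := isFactorization_iff_inner.2 fun Z hZ Y hY x y => by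
  have horth := inner_eq_zero_symm.1 (inner_eq_zero_of_apply_eq hT (h Z hZ y).1 (h Y hY x).2)
  rw [WithLp.prod_inner_apply] at horth
  simpa [neg_add_eq_zero] using horth

theorem IsEigenColumn.isRealFun (h : IsEigenColumn f Φ T) (hT : adjoint T = T)
    (hreal : IsRealOp ((AUI.tensor (TotalIndex n) ιX).prod ι)
      ((AUI.tensor (TotalIndex n) ιX).prod ι) T) :
    IsRealFun ι (AUI.tensor (TotalIndex n) ιX) (halfplane n) Φ :=
  isRealFun_iff.2 fun Z hZ x => by
  set τ := AUI.tensor (TotalIndex n) ιX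
  obtain ⟨hfix, hneg⟩ := h Z hZ x
  have hZ' := conjTuple_mem_halfplane hZ
  have hfix' : T (WithLp.toLp 2 (diagHom n X (conjTuple Z) (τ (Φ Z x)), ι (f Z x))) =
      WithLp.toLp 2 (diagHom n X (conjTuple Z) (τ (Φ Z x)), ι (f Z x)) := by
    rw [← AUI.tensor_diagHom]
    exact (hreal _).symm.trans (congrArg (τ.prod ι) hfix)
  have hneg' : T (WithLp.toLp 2 (-τ (Φ Z x), ι x)) = -WithLp.toLp 2 (-τ (Φ Z x), ι x) := by
    rw [← AUI.map_neg]
    exact (hreal _).symm.trans ((congrArg (τ.prod ι) hneg).trans (AUI.map_neg _ _))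
  exact eq_of_apply_eq_self_of_apply_eq_neg hT (isStrictlyPositive_diagHom_add_star hZ')
    (h _ hZ' (ι x)).1 (h _ hZ' (ι x)).2 hfix' hneg'

theorem IsFactorization.exists_isEigenColumn (h : IsFactorization f Φ)
    (hΦ : IsRealFun ι (AUI.tensor (TotalIndex n) ιX) (halfplane n) Φ) :
    ∃ T, ‖T‖ ≤ 1 ∧ adjoint T = T ∧ T * T = 1 ∧
      IsRealOp ((AUI.tensor (TotalIndex n) ιX).prod ι) ((AUI.tensor (TotalIndex n) ιX).prod ι) T ∧
      IsEigenColumn f Φ T := by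
  let K : Submodule ℂ (WithLp 2 (Tensor (TotalIndex n) X × U)) :=
    Submodule.span ℂ {v | ∃ Z ∈ halfplane n, ∃ x, WithLp.toLp 2 (-Φ Z x, x) = v}
  have : CompleteSpace Kᗮ := K.isClosed_orthogonal.completeSpace_coe
  have : Kᗮ.HasOrthogonalProjection := .ofCompleteSpace _
  refine ⟨reflectionL Kᗮ, LinearIsometry.norm_toContinuousLinearMap_le _, adjoint_reflectionL _,
    reflectionL_mul_self _, isRealOp_reflectionL fun v hv => AUI.mem_orthogonal _ (fun w hw =>
      AUI.mem_span _ ?_ hw) hv, fun Z hZ x => ⟨?_, ?_⟩⟩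
  · rintro _ ⟨Z, hZ, x, rfl⟩
    refine ⟨conjTuple Z, conjTuple_mem_halfplane hZ, ι x, ?_⟩
    rw [isRealFun_iff.1 hΦ Z hZ, ← AUI.map_neg]
    rfl
  · refine Submodule.reflection_mem_subspace_eq_self ((Submodule.mem_orthogonal _ _).2 ?_)
    intro v hv
    induction hv using Submodule.span_induction with
    | mem v hv =>
      obtain ⟨Y, hY, y, rfl⟩ := hv
      simp [WithLp.prod_inner_apply, isFactorization_iff_inner.1 h Z hZ Y hY]
    | zero => exact inner_zero_left _
    | add v w _ _ hv hw => rw [inner_add_left, hv, hw, add_zero]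
    | smul c v _ hv => rw [inner_smul_left, hv, mul_zero]
  · exact Submodule.reflection_mem_subspace_orthogonalComplement_eq_neg
      (K.le_orthogonal_orthogonal (Submodule.subset_span ⟨Z, hZ, x, rfl⟩))


end Realization

section Equivalences

variable {N : ℕ} {n : Fin N → ℕ} {U : Type u} [NormedAddCommGroup U] [InnerProductSpace ℂ U]
  [CompleteSpace U] {ι : AUI U} {f : Tuple n → U →L[ℂ] U}

theorem HasRealFactorization.exists_isLongResolvent (h : HasRealFactorization ι f)
    (hf : DifferentiableOn ℂ f (Omega n)) :
    ∃ (H : Type u) (_ : NormedAddCommGroup H) (_ : InnerProductSpace ℂ H) (_ : CompleteSpace H)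
      (M : Fin N → Type u) (_ : ∀ k, NormedAddCommGroup (M k))
      (_ : ∀ k, InnerProductSpace ℂ (M k)) (_ : ∀ k, CompleteSpace (M k))
      (G : ∀ k, WithLp 2 (U × H) →L[ℂ] Tensor (Fin (n k)) (M k))
      (ιH : AUI H) (ιM : ∀ k, AUI (M k)),
      IsLongResolvent f G ∧
      ∀ k, IsRealOp (ι.prod ιH) (AUI.tensor (Fin (n k)) (ιM k)) (G k) := by
  obtain ⟨X, _, _, _, Φ, ιX, hfact, hΦ⟩ := h
  exact ⟨stateSpace Φ, inferInstance, inferInstance, inferInstance, fun _ => X, inferInstance,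
    inferInstance, inferInstance, fun k => tensorProj n X k ∘L stateOperator Φ, _, fun _ => ιX,
    hfact.isLongResolvent hf, fun k v =>
      congrArg (tensorProj n X k) (isRealOp_stateOperator hΦ v)⟩

theorem HasRealFactorization.exists_isRealization (h : HasRealFactorization ι f) :
    DoubleCayleyDefined f ∧
    ∃ (X : Type u) (_ : NormedAddCommGroup X) (_ : InnerProductSpace ℂ X) (_ : CompleteSpace X)
      (T : WithLp 2 (Tensor (TotalIndex n) X × U) →L[ℂ] WithLp 2 (Tensor (TotalIndex n) X × U))
      (ιX : AUI X),
      IsRealization (doubleCayley f) T ∧ adjoint T = T ∧ T * T = 1 ∧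
      IsRealOp ((AUI.tensor (TotalIndex n) ιX).prod ι) ((AUI.tensor (TotalIndex n) ιX).prod ι)
        T := by
  obtain ⟨X, _, _, _, Φ, ιX, hfact, hΦ⟩ := h
  obtain ⟨T, hnorm, hT, hTT, hreal, hcol⟩ := hfact.exists_isEigenColumn hΦ
  have hdef := hfact.doubleCayleyDefined
  exact ⟨hdef, X, _, _, ‹_›, T, ιX, hcol.isRealization hdef hnorm hTT, hT, hTT, hreal⟩

theorem IsRealization.hasRealFactorization {X : Type u} [NormedAddCommGroup X]
    [InnerProductSpace ℂ X] [CompleteSpace X]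
    {T : WithLp 2 (Tensor (TotalIndex n) X × U) →L[ℂ] WithLp 2 (Tensor (TotalIndex n) X × U)}
    {ιX : AUI X} (h : IsRealization (doubleCayley f) T) (hf : DoubleCayleyDefined f)
    (hT : adjoint T = T) (hTT : T * T = 1)
    (hreal : IsRealOp ((AUI.tensor (TotalIndex n) ιX).prod ι)
      ((AUI.tensor (TotalIndex n) ιX).prod ι) T) : HasRealFactorization ι f := by
  obtain ⟨Φ, hcol⟩ := h.exists_isEigenColumn hf hTT
  exact ⟨X, _, _, ‹_›, Φ, ιX, hcol.isFactorization hT, hcol.isRealFun hT hreal⟩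

end Equivalences

end

end Bessmertnyi

open Bessmertnyi in
theorem mainTheorem4 {N : ℕ} (n : Fin N → ℕ)
    (U : Type u) [NormedAddCommGroup U] [InnerProductSpace ℂ U] [CompleteSpace U]
    (ι : AUI U) (f : Tuple n → U →L[ℂ] U) (hf : DifferentiableOn ℂ f (Omega n)) :
    List.TFAE [
      -- (i)
      MemBessmertnyi n U f ∧ IsRealFun ι ι (Omega n) f,
      -- (ii)
      ∃ (H : Type u) (_ : NormedAddCommGroup H) (_ : InnerProductSpace ℂ H) (_ : CompleteSpace H)
        (M : Fin N → Type u) (_ : ∀ k, NormedAddCommGroup (M k))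
        (_ : ∀ k, InnerProductSpace ℂ (M k)) (_ : ∀ k, CompleteSpace (M k))
        (G : ∀ k, WithLp 2 (U × H) →L[ℂ] Tensor (Fin (n k)) (M k))
        (ιH : AUI H) (ιM : ∀ k, AUI (M k)),
        IsLongResolvent f G ∧
        ∀ k, IsRealOp (ι.prod ιH) (AUI.tensor (Fin (n k)) (ιM k)) (G k),
      -- (iii)
      ∃ (M : Fin N → Type u) (_ : ∀ k, NormedAddCommGroup (M k))
        (_ : ∀ k, InnerProductSpace ℂ (M k)) (_ : ∀ k, CompleteSpace (M k))
        (φ : ∀ k, Tuple n → U →L[ℂ] Tensor (Fin (n k)) (M k))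
        (ιM : ∀ k, AUI (M k)),
        IsDecomposition f φ ∧
        ∀ k, IsRealFun ι (AUI.tensor (Fin (n k)) (ιM k)) (halfplane n) (φ k),
      -- (iv)
      DoubleCayleyDefined f ∧
      ∃ (X : Type u) (_ : NormedAddCommGroup X) (_ : InnerProductSpace ℂ X) (_ : CompleteSpace X)
        (T : WithLp 2 (Tensor (TotalIndex n) X × U) →L[ℂ] WithLp 2 (Tensor (TotalIndex n) X × U))
        (ιX : AUI X),
        IsRealization (doubleCayley f) T ∧
        ContinuousLinearMap.adjoint T = T ∧ T * T = 1 ∧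
        IsRealOp ((AUI.tensor (TotalIndex n) ιX).prod ι) ((AUI.tensor (TotalIndex n) ιX).prod ι) T
    ] := by
  tfae_have 1 → 2 := by
    rintro ⟨⟨-, H, _, _, _, M, _, _, _, G, hG⟩, hreal⟩
    exact (hG.isDecomposition.isFactorization.hasRealFactorization fun Z hZ =>
      hreal Z (halfplane_subset_Omega hZ)).exists_isLongResolvent hf
  tfae_have 2 → 1 := by
    rintro ⟨H, _, _, _, M, _, _, _, G, ιH, ιM, hG, hreal⟩
    exact ⟨⟨hf, H, _, _, ‹_›, M, _, _, ‹_›, G, hG⟩, hG.isRealFun hreal⟩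
  tfae_have 2 → 3 := by
    rintro ⟨H, _, _, _, M, _, _, _, G, ιH, ιM, hG, hreal⟩
    exact ⟨M, _, _, ‹_›, _, ιM, hG.isDecomposition, fun k Z hZ =>
      hG.isRealFun_comp_schurColumn hreal k Z (halfplane_subset_Omega hZ)⟩
  tfae_have 3 → 4 := by
    rintro ⟨M, _, _, _, φ, ιM, hφ, hreal⟩
    exact HasRealFactorization.exists_isRealization
      ⟨PiLp 2 M, _, _, inferInstance, _, AUI.pi ιM, hφ.isFactorization,
        isRealFun_tensorColumn hreal⟩
  tfae_have 4 → 2 := by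
    rintro ⟨hdef, X, _, _, _, T, ιX, hrepr, hT, hTT, hreal⟩
    exact (hrepr.hasRealFactorization hdef hT hTT hreal).exists_isLongResolvent hf
  tfae_finish
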